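/- Let $M$ be a finite binary matroid (one represented by a matrix over $\mathbb{F}_2$) and let $K$ be a field. A *cycle* of $M$ is a disjoint union of circuits of $M$, possibly empty; $\mathrm{Cyc}(M)$ is the set of cycles. The *cycle ideal* $I_{\mathrm{Cyc}(M)}$ is the kernel of the $K$-algebra homomorphism $$K[x_C : C\in \mathrm{Cyc}(M)]\to K[z,\,y_e : e\in E(M)],\qquad x_C\mapsto z\prod_{e\in C}y_e ,$$ and $\mu(M)$ is the highest degree of an element of a minimal homogeneous generating set of $I_{\mathrm{Cyc}(M)}$, where all $x_C$ have degree $1$ and $\mu(M)=-\infty$ if the ideal is zero. A *series contraction* of a matroid $N$ is $N/e$ with $e$ in a $2$-element cocircuit of $N$; a *coloop contraction* of $N$ is $N/e$ with $e$ a coloop of $N$. A *binary matroidal retract* of a binary matroid $N$ is a matroid $N/E'$, where $E=\{e_1,\dots,e_s\}$ and $E'=\{e'_1,\dots,e'_s\}$ are disjoint $s$-element subsets of $E(N)$, $s\ge 1$, such that $E'$ is a circuit of $N$ and, for every circuit $C$ of $N$ and every $J\subsetneq\{1,\dots,s\}$, writing $E_J=\{e_j: j\in J\}$ and $E'_J=\{e'_j: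 j\in J\}$, * if $C\cap E'=E'_J$, then $C\cap E=E_J$ or $C\cap E=E\setminus E_J$; * if $C\cap E=E_J$, then $C\cap E'=E'_J$ or $C\cap E'=E'\setminus E'_J$. A *g-series minor* of $M$ is a matroid obtained from $M$ by a finite (possibly empty) sequence of deletions of elements, series contractions, coloop contractions and binary matroidal retracts. Let $M(K_5)^*$ be the dual of the cycle matroid of the complete graph $K_5$. Consider the statements * (a) $\mu(M)\le 5$; * (b) no g-series minor of $M$ is isomorphic to $M(K_5)^*$; * (c) no matroid obtained from $M$ by a finite (possibly empty) sequence of deletions, series contractions and coloop contractions is isomorphic to $M(K_5)^*$. Then (a) implies (b), and (b) implies (c). -/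

import Mathlib

open Set

noncomputable section

namespace Matroid

universe u v w

/-! ### Binary matroids and isomorphism -/

/-- `M` is the vector matroid over `𝔽₂` of a matrix whose columns are labelled by `M.E`. -/
def IsBinary {α : Type u} (M : Matroid α) : Prop :=
  ∃ (m : ℕ) (A : Matrix (Fin m) M.E (ZMod 2)), ∀ I : Set M.E,
    M.Indep (Subtype.val '' I) ↔ LinearIndepOn (ZMod 2) A.col I

/-- Two matroids are isomorphic: some bijection between the ground sets preserves independence. -/
def IsIsoTo {α : Type u} {β : Type v} (M : Matroid α) (N : Matroid β) : Prop :=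
  ∃ f : M.E ≃ N.E, ∀ I : Set M.E,
    M.Indep (Subtype.val '' I) ↔ N.Indep (Subtype.val '' (f '' I))

/-! ### Cycles, the cycle ideal, and its highest generator degree -/

/-- `Cyc(M)`: the disjoint unions of circuits of `M` (in particular `∅`). -/
def Cyc {α : Type u} (M : Matroid α) : Set (Set α) :=
  {C | ∃ 𝒟 : Set (Set α), (∀ D ∈ 𝒟, M.IsCircuit D) ∧ 𝒟.PairwiseDisjoint id ∧ C = ⋃₀ 𝒟}

/-- `φ_M : K[x_C : C ∈ Cyc(M)] → K[y_e, z : e ∈ E(M)]`, `x_C ↦ (∏_{e ∈ C} y_e) z`.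
The variable `y_e` is `X (some e)` and `z` is `X none`. -/
def cycleHom {α : Type u} (K : Type w) [Field K] (M : Matroid α) :
    MvPolynomial M.Cyc K →ₐ[K] MvPolynomial (Option M.E) K :=
  MvPolynomial.aeval fun C : M.Cyc =>
    (∏ᶠ (e : M.E) (_ : (e : α) ∈ (C : Set α)), MvPolynomial.X (some e)) * MvPolynomial.X none

/-- The cycle ideal `I_{Cyc(M)}`, the kernel of `φ_M`. -/
def cycleIdeal {α : Type u} (K : Type w) [Field K] (M : Matroid α) :
    Ideal (MvPolynomial M.Cyc K) :=
  RingHom.ker (cycleHom K M)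

/-- `S` is a minimal homogeneous generating set of the ideal `I` (all variables in degree `1`):
a set of homogeneous polynomials that generates `I`, no proper subset of which generates `I`. -/
def IsMinHomGenSet {σ : Type u} {K : Type w} [Field K] (I : Ideal (MvPolynomial σ K))
    (S : Set (MvPolynomial σ K)) : Prop :=
  Minimal (fun T : Set (MvPolynomial σ K) =>
    (∀ f ∈ T, ∃ d : ℕ, f.IsHomogeneous d) ∧ Ideal.span T = I) S

/-- `μ(M)`: the highest degree of an element of a minimal homogeneous generating set of the cycle
ideal. The degrees that occur do not depend on the minimal generating set, so the supremum over all
of them is that of any one. The zero ideal has the minimal generating set `∅`, so its value is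
`⊥`, that is, `-∞`. -/
def mu {α : Type u} (K : Type w) [Field K] (M : Matroid α) : WithBot ℕ∞ :=
  ⨆ (S : Set (MvPolynomial M.Cyc K)) (_ : IsMinHomGenSet (cycleIdeal K M) S) (f ∈ S),
    ((f.totalDegree : ℕ∞) : WithBot ℕ∞)

/-! ### Minor operations -/

/-- `M'` is the deletion of an element from `M`. -/
def IsDeletionOf {α : Type u} (M M' : Matroid α) : Prop :=
  ∃ e ∈ M.E, M' = M ＼ {e}

/-- `M'` is `M / e` for an element `e` of a `2`-element cocircuit of `M`. -/
def IsSeriesContractionOf {α : Type u} (M M' : Matroid α) : Prop :=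
  ∃ e f, e ≠ f ∧ M.IsCocircuit {e, f} ∧ M' = M ／ {e}

/-- `M'` is `M / e` for a coloop `e` of `M`. -/
def IsColoopContractionOf {α : Type u} (M M' : Matroid α) : Prop :=
  ∃ e, M.IsColoop e ∧ M' = M ／ {e}

/-- `M'` is a binary matroidal retract of the binary matroid `M`: there are disjoint subsets
`E = {e₁, …, eₛ}` and `E' = {e'₁, …, e'ₛ}` of `M.E`, `s ≥ 1`, such that `E'` is a circuit,
`M' = M / E'`, and each circuit `C` meets `E` and `E'` in corresponding subsets up to
complementation, whenever one of these two intersections is known to be proper. -/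
def IsBinaryMatroidalRetractOf {α : Type u} (M M' : Matroid α) : Prop :=
  M.IsBinary ∧ ∃ (s : ℕ) (a a' : Fin s → α), 1 ≤ s ∧
    Function.Injective a ∧ Function.Injective a' ∧
    Disjoint (range a) (range a') ∧ range a ⊆ M.E ∧ range a' ⊆ M.E ∧
    M.IsCircuit (range a') ∧
    (∀ C, M.IsCircuit C → ∀ J : Set (Fin s), J ≠ univ →
      (C ∩ range a' = a' '' J → C ∩ range a = a '' J ∨ C ∩ range a = range a \ a '' J) ∧
      (C ∩ range a = a '' J → C ∩ range a' = a' '' J ∨ C ∩ range a' = range a' \ a' '' J)) ∧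
    M' = M ／ range a'

/-- `M'` is obtained from `M` by a (possibly empty) sequence of deletions, series contractions and
coloop contractions. -/
def IsSeriesColoopMinorOf {α : Type u} (M M' : Matroid α) : Prop :=
  Relation.ReflTransGen (fun N N' => IsDeletionOf N N' ∨ IsSeriesContractionOf N N' ∨
    IsColoopContractionOf N N') M M'

/-- `M'` is a g-series minor of `M`: it is obtained from `M` by a (possibly empty) sequence of
deletions, series contractions, coloop contractions and binary matroidal retracts. -/
def IsGSeriesMinorOf {α : Type u} (M M' : Matroid α) : Prop :=
  Relation.ReflTransGen (fun N N' => IsDeletionOf N N' ∨ IsSeriesContractionOf N N' ∨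
    IsColoopContractionOf N N' ∨ IsBinaryMatroidalRetractOf N N') M M'

/-- No g-series minor of `M` is isomorphic to `N`. -/
def GSeriesMinorFree {α : Type u} {β : Type v} (M : Matroid α) (N : Matroid β) : Prop :=
  ¬ ∃ M' : Matroid α, IsGSeriesMinorOf M M' ∧ M'.IsIsoTo N

/-- No matroid obtained from `M` by deletions, series contractions and coloop contractions is
isomorphic to `N`. -/
def SeriesColoopMinorFree {α : Type u} {β : Type v} (M : Matroid α) (N : Matroid β) : Prop :=
  ¬ ∃ M' : Matroid α, IsSeriesColoopMinorOf M M' ∧ M'.IsIsoTo N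

end Matroid

/-! ### The cycle matroid of a finite simple graph -/

namespace SimpleGraph

universe u

/-- `I` is the edge set of a forest contained in `G`. -/
def IsForestEdgeSet {V : Type u} (G : SimpleGraph V) (I : Set (Sym2 V)) : Prop :=
  I ⊆ G.edgeSet ∧ (fromEdgeSet I).IsAcyclic

/-- The incidence vector over `𝔽₂` of an edge. -/
def incVec {V : Type u} [DecidableEq V] : Sym2 V → V → ZMod 2 :=
  Sym2.lift ⟨fun a b => Pi.single a 1 + Pi.single b 1, fun _ _ => add_comm _ _⟩

theorem incVec_mem_span {V : Type u} [DecidableEq V] (I : Set (Sym2 V)) {x y : V}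
    (h : (fromEdgeSet I).Reachable x y) :
    incVec s(x, y) ∈ Submodule.span (ZMod 2) (incVec '' I) := by
  obtain ⟨p⟩ := h
  induction p with
  | nil =>
    rename_i x
    have : (incVec s(x, x) : V → ZMod 2) = 0 := by
      funext z
      exact CharTwo.add_self_eq_zero _
    rw [this]; exact Submodule.zero_mem _
  | @cons x y z hxy p ih =>
    have h1 : (incVec s(x, z) : V → ZMod 2) = incVec s(x, y) + incVec s(y, z) := by
      have : (Pi.single y 1 + Pi.single y 1 : V → ZMod 2) = 0 := by
        funext z
        exact CharTwo.add_self_eq_zero _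
      simp only [incVec, Sym2.lift_mk]
      linear_combination -this
    rw [h1]
    exact Submodule.add_mem _
      (Submodule.subset_span ⟨_, ((fromEdgeSet_adj I).1 hxy).1, rfl⟩) ih

theorem incVec_notMem_span {V : Type u} [Fintype V] [DecidableEq V] (I : Set (Sym2 V)) {x y : V}
    (h : ¬ (fromEdgeSet I).Reachable x y) :
    incVec s(x, y) ∉ Submodule.span (ZMod 2) (incVec '' I) := by
  classical
  let φ : (V → ZMod 2) →ₗ[ZMod 2] ZMod 2 :=
    Fintype.linearCombination (ZMod 2)
      fun z => if (fromEdgeSet I).Reachable x z then (1 : ZMod 2) else 0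
  have hφ : ∀ a b, φ (incVec s(a, b)) = (if (fromEdgeSet I).Reachable x a then (1 : ZMod 2) else 0)
      + (if (fromEdgeSet I).Reachable x b then (1 : ZMod 2) else 0) := by
    intro a b
    simp [φ, incVec, Fintype.linearCombination_apply_single]
  have hker : Submodule.span (ZMod 2) (incVec '' I) ≤ LinearMap.ker φ := by
    rw [Submodule.span_le]
    rintro _ ⟨e, he, rfl⟩
    induction e with | _ a b =>
    simp only [SetLike.mem_coe, LinearMap.mem_ker, hφ]
    by_cases hab : a = b
    · subst hab; exact CharTwo.add_self_eq_zero _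
    · have hr : (fromEdgeSet I).Reachable a b := ((fromEdgeSet_adj I).2 ⟨he, hab⟩).reachable
      have : (fromEdgeSet I).Reachable x a ↔ (fromEdgeSet I).Reachable x b :=
        ⟨fun h => h.trans hr, fun h => h.trans hr.symm⟩
      simp only [this]
      exact CharTwo.add_self_eq_zero _
  intro hmem
  have := hker hmem
  rw [LinearMap.mem_ker, hφ, if_pos (Reachable.refl x), if_neg h] at this
  simp at this

theorem isAcyclic_fromEdgeSet_insert {V : Type u} {I : Set (Sym2 V)} {x y : V}
    (hI : (fromEdgeSet I).IsAcyclic) (h : ¬ (fromEdgeSet I).Reachable x y) :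
    (fromEdgeSet (insert s(x, y) I)).IsAcyclic := by
  have := (isAcyclic_add_edge_iff_of_not_reachable x y h).2 hI
  rwa [edge, ← fromEdgeSet_union, Set.union_singleton] at this

theorem not_reachable_of_isAcyclic_insert {V : Type u} {I : Set (Sym2 V)} {x y : V}
    (hxy : x ≠ y) (hn : s(x, y) ∉ I) (hI : (fromEdgeSet (insert s(x, y) I)).IsAcyclic) :
    ¬ (fromEdgeSet I).Reachable x y := by
  have hb := isAcyclic_iff_forall_isBridge.1 hI (e := s(x, y)) (by simp [hxy])
  rw [isBridge_iff] at hb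
  intro hr
  refine hb (hr.mono ?_)
  intro a b hab
  have hab' := (fromEdgeSet_adj I).1 hab
  have hne : s(a, b) ≠ s(x, y) := fun he => hn (he ▸ hab'.1)
  simp [hab'.1, hab'.2, hne]

theorem IsForestEdgeSet.linearIndepOn {V : Type u} [Fintype V] [DecidableEq V] {G : SimpleGraph V}
    {I : Set (Sym2 V)} (hI : G.IsForestEdgeSet I) : LinearIndepOn (ZMod 2) incVec I := by
  have hfin : I.Finite := Set.toFinite I
  induction I, hfin using Set.Finite.induction_on with
  | empty => exact linearIndepOn_empty _ _
  | @insert e I he _ ih =>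
    induction e with | _ x y =>
    have hadj : G.Adj x y := hI.1 (Set.mem_insert _ _)
    have hsub : G.IsForestEdgeSet I := ⟨(Set.subset_insert _ _).trans hI.1,
      hI.2.anti (fromEdgeSet_mono (Set.subset_insert _ _))⟩
    rw [linearIndepOn_insert he]
    exact ⟨ih hsub, incVec_notMem_span I (not_reachable_of_isAcyclic_insert hadj.ne he hI.2)⟩

theorem IsForestEdgeSet.exists_insert {V : Type u} [Fintype V] {G : SimpleGraph V}
    {I J : Set (Sym2 V)} (hI : G.IsForestEdgeSet I) (hJ : G.IsForestEdgeSet J)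
    (hlt : I.ncard < J.ncard) : ∃ e ∈ J, e ∉ I ∧ G.IsForestEdgeSet (insert e I) := by
  classical
  by_contra! hcon
  have hspan : ∀ e ∈ J, (incVec e : V → ZMod 2) ∈ Submodule.span (ZMod 2) (incVec '' I) := by
    intro e he
    by_cases heI : e ∈ I
    · exact Submodule.subset_span ⟨e, heI, rfl⟩
    · have hc := hcon e he heI
      induction e with | _ x y =>
      by_contra hn
      exact hc ⟨Set.insert_subset (hJ.1 he) hI.1,
        isAcyclic_fromEdgeSet_insert hI.2 fun hr => hn (incVec_mem_span I hr)⟩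
  have hJli := hJ.linearIndepOn
  have h1 : J.ncard ≤ Module.finrank (ZMod 2) (Submodule.span (ZMod 2) (incVec '' I)) := by
    have : LinearIndependent (ZMod 2)
        (fun e : J => (⟨incVec e.1, hspan e.1 e.2⟩ : Submodule.span (ZMod 2) (incVec '' I))) :=
      LinearIndependent.of_comp (Submodule.subtype _) hJli
    have := this.fintype_card_le_finrank
    rwa [← Nat.card_eq_fintype_card, Nat.card_coe_set_eq] at this
  have h2 : Module.finrank (ZMod 2) (Submodule.span (ZMod 2) (incVec '' I)) ≤ I.ncard := by
    refine (finrank_span_le_card (R := ZMod 2) (incVec '' I)).trans ?_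
    rw [← Set.ncard_eq_toFinset_card']
    exact Set.ncard_image_le (Set.toFinite I)
  omega

/-- The cycle matroid `M(G)` of a finite simple graph `G`: its ground set is the edge set of `G`,
and a set of edges is independent if and only if it contains no cycle of `G`. -/
def cycleMatroid {V : Type u} [Fintype V] (G : SimpleGraph V) : Matroid (Sym2 V) :=
  (IndepMatroid.ofFinite (E := G.edgeSet) (Set.toFinite _) G.IsForestEdgeSet
    ⟨Set.empty_subset _, by rw [fromEdgeSet_empty]; exact isAcyclic_bot⟩
    (fun _ _ hJ hIJ => ⟨hIJ.trans hJ.1, hJ.2.anti (fromEdgeSet_mono hIJ)⟩)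
    (fun _ _ hI hJ hlt => hI.exists_insert hJ hlt)
    (fun _ hI => hI.1)).matroid

end SimpleGraph

end

/-! The invariant that travels is "the cycle ideal is generated in degree at most `d`". Since every
`x_C` maps to a monomial of degree one in `z`, the ideal is homogeneous, so a minimal homogeneous
generating set exists and `μ(M) ≤ 5` gives the invariant with `d = 5`
(`generatedInDegreeLE_of_mu_le`).

Each operation, and each isomorphism, presents the new polynomial ring in the cycle variables as a
graded retract of the old one, compatibly with the cycle homomorphisms, and
`GeneratedInDegreeLE.of_retract` transports the invariant. For a deletion, the cycles that meet the
deleted set are sent to zero. For a contraction of `D`, the retraction is `C ↦ C \ D`, and a section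
exists as soon as each `x ∈ D` can be restored by copying an element `a x`
(`generatedInDegreeLE_contract`). A series pair, a coloop and a matroidal retract all supply such an
`a`.

The invariant fails for `M(K₅)*` with `d = 5`. Its cycles are the 16 cuts of `K₅`, and one monomial
of degree 6 shares no variable with any other monomial of its nontrivial fibre, which forces a
generator of degree 6 (`not_generatedInDegreeLE_of_fiber`). So `M(K₅)*` is not a g-series minor. The
second implication holds because the operations in (c) are among those in (b). -/

namespace MvPolynomial

-- Toric ideals: retracts, homogeneity, isolated monomials in fibres.

universe u v w

/-- The ideal `I` is generated by its homogeneous elements of degree at most `d`. -/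
def GeneratedInDegreeLE {σ : Type u} {K : Type w} [Field K] (I : Ideal (MvPolynomial σ K))
    (d : ℕ) : Prop :=
  I ≤ Ideal.span {f | f ∈ I ∧ ∃ k ≤ d, f.IsHomogeneous k}

/-- Generation in bounded degree passes to the kernel of a retract. -/
theorem GeneratedInDegreeLE.of_retract {σ : Type u} {σ' : Type v} {K : Type w} [Field K]
    {A A' : Type*} [CommRing A] [Algebra K A] [CommRing A'] [Algebra K A']
    {φ : MvPolynomial σ K →ₐ[K] A} {φ' : MvPolynomial σ' K →ₐ[K] A'} {d : ℕ}
    (h : GeneratedInDegreeLE (RingHom.ker φ) d)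
    (p : σ → MvPolynomial σ' K) (ι : σ' → σ) (ρ : A →ₐ[K] A') (j : A' →ₐ[K] A)
    (hp : ∀ c, (p c).IsHomogeneous 1) (hpι : ∀ c, p (ι c) = X c)
    (hρ : ∀ c, φ' (p c) = ρ (φ (X c))) (hj : ∀ c, φ (X (ι c)) = j (φ' (X c))) :
    GeneratedInDegreeLE (RingHom.ker φ') d := by
  have h1 : φ'.comp (aeval p) = ρ.comp φ := by ext c; simp [hρ]
  have h2 : φ.comp (rename ι) = j.comp φ' := by ext c; simp [hj]
  have h3 : (aeval p).comp (rename ι) = AlgHom.id K (MvPolynomial σ' K) := by ext c; simp [hpι]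
  intro f hf
  have hmem : rename ι f ∈ RingHom.ker φ := by
    have := DFunLike.congr_fun h2 f
    simp only [AlgHom.comp_apply] at this
    rw [RingHom.mem_ker] at hf ⊢
    rw [this, hf, map_zero]
  have hfe : f = (aeval p : MvPolynomial σ K →ₐ[K] MvPolynomial σ' K).toRingHom (rename ι f) :=
    (DFunLike.congr_fun h3 f).symm
  rw [hfe]
  -- Expand the lift `rename ι f` in generators of `ker φ` and push the expansion back along `p`. As
  -- `p` sends variables to linear forms, degrees of generators are kept.
  have := Ideal.mem_map_of_mem (aeval p : MvPolynomial σ K →ₐ[K] MvPolynomial σ' K).toRingHom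
    (h hmem)
  rw [Ideal.map_span] at this
  refine Ideal.span_mono ?_ this
  rintro _ ⟨g, ⟨hg, k, hk, hgk⟩, rfl⟩
  refine ⟨?_, k, hk, ?_⟩
  · have := DFunLike.congr_fun h1 g
    simp only [AlgHom.comp_apply] at this
    rw [RingHom.mem_ker] at hg ⊢
    exact this.trans (by rw [hg, map_zero])
  · have := IsHomogeneous.aeval hgk p hp
    rwa [one_mul] at this

/-- The image of a monomial under a homomorphism that sends variables to monic monomials. -/
theorem map_monomial_of_map_X {σ : Type u} {τ : Type v} {K : Type w} [Field K]
    {φ : MvPolynomial σ K →ₐ[K] MvPolynomial τ K} {a : σ → τ →₀ ℕ}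
    (hφ : ∀ c, φ (X c) = monomial (a c) 1) (n : σ →₀ ℕ) (r : K) :
    φ (monomial n r) = monomial (n.sum fun c k => k • a c) r := by
  rw [monomial_eq, map_mul, algHom_C, Finsupp.prod, map_prod]
  simp only [map_pow, hφ, monomial_pow, one_pow]
  rw [← monomial_sum_one, algebraMap_eq, C_mul_monomial, mul_one, Finsupp.sum]

/-- The kernel of a homomorphism that sends variables to monomials of degree `1` in some fixed
variable `o` is homogeneous. -/
theorem homogeneousComponent_mem_ker {σ : Type u} {τ : Type v} {K : Type w} [Field K]
    {φ : MvPolynomial σ K →ₐ[K] MvPolynomial τ K} {a : σ → τ →₀ ℕ}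
    (hφ : ∀ c, φ (X c) = monomial (a c) 1) {o : τ} (ho : ∀ c, a c o = 1)
    {f : MvPolynomial σ K} (hf : f ∈ RingHom.ker φ) (n : ℕ) :
    homogeneousComponent n f ∈ RingHom.ker φ := by
  classical
  have hdeg : ∀ v : σ →₀ ℕ, (v.sum fun c k => k • a c) o = v.degree := fun v => by
    simp [Finsupp.sum, Finsupp.finsetSum_apply, ho, Finsupp.degree_apply]
  rw [RingHom.mem_ker] at hf ⊢
  have hsum : ∀ t : Finset (σ →₀ ℕ), φ (∑ v ∈ t, monomial v (coeff v f)) =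
      ∑ v ∈ t, monomial (v.sum fun c k => k • a c) (coeff v f) := fun t => by
    rw [map_sum]
    exact Finset.sum_congr rfl fun v _ => map_monomial_of_map_X hφ v _
  rw [f.as_sum, hsum] at hf
  rw [homogeneousComponent_apply, hsum]
  ext b
  have hb := congrArg (coeff b) hf
  simp only [coeff_sum, coeff_monomial, coeff_zero] at hb ⊢
  rw [Finset.sum_filter]
  -- The exponent of `o` in the image records the degree, so only monomials of degree `b o`
  -- contribute at `b`: the sum is either all of the coefficient of `φ f` at `b`, or empty.
  by_cases hbn : b o = n
  · refine (Finset.sum_congr rfl fun v _ => ?_).trans hb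
    by_cases hv : (v.sum fun c k => k • a c) = b
    · rw [if_pos (by rw [← hdeg, hv, hbn])]
    · rw [if_neg hv, ite_self]
  · refine Finset.sum_eq_zero fun v _ => ?_
    by_cases hv : (v.sum fun c k => k • a c) = b
    · rw [if_neg (by rw [← hdeg, hv]; exact hbn)]
    · rw [if_neg hv, ite_self]

/-- If the monomial `u` shares no variable with any other monomial of its fibre, and this fibre has
another element, then the toric ideal needs a generator of the degree of `u`. -/
theorem not_generatedInDegreeLE_of_fiber {σ : Type u} {τ : Type v} {K : Type w} [Field K]
    {φ : MvPolynomial σ K →ₐ[K] MvPolynomial τ K} {a : σ → τ →₀ ℕ}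
    (hφ : ∀ c, φ (X c) = monomial (a c) 1) {u w : σ →₀ ℕ} {d : ℕ} (hd : d < u.degree)
    (huw : u ≠ w)
    (hw : (w.sum fun c k => k • a c) = u.sum fun c k => k • a c)
    (hu : ∀ n : σ →₀ ℕ, (n.sum fun c k => k • a c) = (u.sum fun c k => k • a c) →
      (∃ c, n c ≠ 0 ∧ u c ≠ 0) → n = u) :
    ¬ GeneratedInDegreeLE (RingHom.ker φ) d := by
  classical
  have hadd : ∀ m n : σ →₀ ℕ, ((m + n).sum fun c k => k • a c) =
      (m.sum fun c k => k • a c) + n.sum fun c k => k • a c := fun m n =>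
    Finsupp.sum_add_index' (fun _ => zero_smul _ _) (fun _ _ _ => add_smul _ _ _)
  -- A divisor `v` of `u` occurring in `g` is proper, by degree. If `n` lies in the fibre of `v`,
  -- then `n + (u - v)` lies in the fibre of `u` and shares a variable with `u`, so `n = v`. Nothing
  -- can then cancel the term of `v` in `φ g`.
  have hg : ∀ g : MvPolynomial σ K, g ∈ RingHom.ker φ → (∃ k ≤ d, g.IsHomogeneous k) →
      ∀ v ≤ u, coeff v g = 0 := by
    rintro g hg ⟨k, hk, hgk⟩ v hv
    by_contra hne
    have hvk : v.degree = k := by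
      by_contra h
      exact hne (hgk.coeff_eq_zero h)
    have hvu : v ≠ u := by rintro rfl; omega
    have hsum : φ g = ∑ n ∈ g.support, monomial (n.sum fun c k => k • a c) (coeff n g) := by
      conv_lhs => rw [g.as_sum, map_sum]
      exact Finset.sum_congr rfl fun n _ => map_monomial_of_map_X hφ n _
    have h0 := congrArg (coeff (v.sum fun c k => k • a c)) hsum
    rw [RingHom.mem_ker.1 hg, coeff_zero, coeff_sum, Finset.sum_eq_single v] at h0
    · rw [coeff_monomial, if_pos rfl] at h0
      exact hne h0.symm
    · intro n _ hnv
      rw [coeff_monomial, if_neg]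
      intro hn
      apply hnv
      have hvu' : v + (u - v) = u := add_tsub_cancel_of_le hv
      have := hu (n + (u - v)) (by rw [hadd, hn, ← hadd, hvu']) (by
        have : u - v ≠ 0 := fun h => hvu (by rwa [h, add_zero] at hvu')
        obtain ⟨c, hc⟩ := Finsupp.ne_iff.1 this
        simp only [Finsupp.tsub_apply, Finsupp.zero_apply] at hc
        exact ⟨c, by simp only [Finsupp.add_apply, Finsupp.tsub_apply]; omega, by omega⟩)
      exact add_right_cancel (this.trans hvu'.symm)
    · intro h
      exact absurd (by simpa using h) hne
  intro hgen
  have hker : monomial u (1 : K) - monomial w 1 ∈ RingHom.ker φ := by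
    rw [RingHom.mem_ker, map_sub, map_monomial_of_map_X hφ, map_monomial_of_map_X hφ, hw, sub_self]
  -- Vanishing at all divisors of `u`, not only at `u`, is what survives multiplication by arbitrary
  -- polynomials.
  have hzero : ∀ f ∈ Ideal.span {f | f ∈ RingHom.ker φ ∧ ∃ k ≤ d, f.IsHomogeneous k},
      ∀ v ≤ u, coeff v f = 0 := by
    intro f hf
    refine Submodule.span_induction (fun f hf => hg f hf.1 hf.2) (fun _ _ => coeff_zero _)
      (fun f g _ _ hf hg v hv => by rw [coeff_add, hf v hv, hg v hv, add_zero])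
      (fun r f _ hf v hv => ?_) hf
    rw [smul_eq_mul, coeff_mul]
    refine Finset.sum_eq_zero fun x hx => ?_
    have hx' : x.1 + x.2 = v := Finset.HasAntidiagonal.mem_antidiagonal.1 hx
    rw [hf x.2 ((hx' ▸ le_add_self : x.2 ≤ v).trans hv), mul_zero]
  have := hzero _ (hgen hker) u le_rfl
  rw [coeff_sub, coeff_monomial, coeff_monomial, if_pos rfl, if_neg huw.symm, sub_zero] at this
  exact one_ne_zero this

/-- A homogeneous ideal in finitely many variables has a minimal homogeneous generating set. -/
theorem exists_isMinHomGenSet {σ : Type u} [Finite σ] {K : Type w} [Field K]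
    {I : Ideal (MvPolynomial σ K)}
    (hI : ∀ f ∈ I, ∀ n, homogeneousComponent n f ∈ I) : ∃ S, Matroid.IsMinHomGenSet I S := by
  classical
  obtain ⟨T, hT⟩ := (isNoetherian_def.1 (inferInstance : IsNoetherianRing (MvPolynomial σ K))) I
  let U : Set (MvPolynomial σ K) :=
    ⋃ f ∈ T, (fun n => homogeneousComponent n f) '' ((Finset.range (f.totalDegree + 1) : Set ℕ))
  have hUfin : U.Finite := T.finite_toSet.biUnion fun f _ => (Finset.finite_toSet _).image _
  have hU : (∀ f ∈ U, ∃ d : ℕ, f.IsHomogeneous d) ∧ Ideal.span U = I := by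
    refine ⟨?_, le_antisymm ?_ ?_⟩
    · simp only [U, mem_iUnion, mem_image]
      rintro _ ⟨f, _, n, _, rfl⟩
      exact ⟨n, homogeneousComponent_isHomogeneous n f⟩
    · rw [Ideal.span_le]
      simp only [U, iUnion_subset_iff]
      rintro f hf _ ⟨n, _, rfl⟩
      exact hI f (hT ▸ Submodule.subset_span hf) n
    · rw [← hT]
      refine Submodule.span_le.2 fun f hf => ?_
      rw [← sum_homogeneousComponent f]
      refine Ideal.sum_mem _ fun n hn => Ideal.subset_span ?_
      simp only [U, mem_iUnion]
      exact ⟨f, hf, n, hn, rfl⟩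
  have hfin : {T | T ⊆ U ∧ (∀ f ∈ T, ∃ d : ℕ, f.IsHomogeneous d) ∧ Ideal.span T = I}.Finite :=
    hUfin.finite_subsets.subset fun T hT => hT.1
  obtain ⟨S, -, hS⟩ := hfin.isPWO.exists_le_minimal ⟨Subset.rfl, hU⟩
  -- Minimality among subsets of the finite set `U` is absolute, since any competitor below `S` is
  -- again a subset of `U`.
  exact ⟨S, hS.prop.2, fun T hT hTS => hS.le_of_le ⟨hTS.trans hS.prop.1, hT⟩ hTS⟩

end MvPolynomial

namespace Matroid

universe u v w

variable {α : Type u} {M : Matroid α}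

/-! ### Cycle spaces -/

theorem IsCircuit.mem_cyc {C : Set α} (hC : M.IsCircuit C) : C ∈ M.Cyc :=
  ⟨{C}, by simpa using hC, pairwiseDisjoint_singleton _ _, by simp⟩

theorem empty_mem_cyc : (∅ : Set α) ∈ M.Cyc :=
  ⟨∅, by simp, pairwiseDisjoint_empty, by simp⟩

theorem subset_ground_of_mem_cyc {C : Set α} (hC : C ∈ M.Cyc) : C ⊆ M.E := by
  obtain ⟨𝒟, h𝒟, -, rfl⟩ := hC
  exact sUnion_subset fun D hD => (h𝒟 D hD).subset_ground

theorem exists_isCircuit_mem_subset {C : Set α} (hC : C ∈ M.Cyc) {e : α} (he : e ∈ C) :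
    ∃ D ⊆ C, e ∈ D ∧ M.IsCircuit D := by
  obtain ⟨𝒟, h𝒟, -, rfl⟩ := hC
  obtain ⟨D, hD, heD⟩ := he
  exact ⟨D, subset_sUnion_of_mem hD, heD, h𝒟 D hD⟩

/-- A property of the circuits that is preserved by symmetric differences holds for all cycles. -/
theorem cyc_induction [M.Finite] {P : Set α → Prop} (h0 : P ∅)
    (hc : ∀ C, M.IsCircuit C → P C) (hs : ∀ C D, P C → P D → P (symmDiff C D))
    {C : Set α} (hC : C ∈ M.Cyc) : P C := by
  obtain ⟨𝒟, h𝒟, hdisj, rfl⟩ := hC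
  have hfin : 𝒟.Finite :=
    M.ground_finite.finite_subsets.subset fun D hD => (h𝒟 D hD).subset_ground
  induction 𝒟, hfin using Set.Finite.induction_on with
  | empty => simpa using h0
  | @insert D 𝒟 hD _ ih =>
    rw [pairwiseDisjoint_insert_of_notMem hD] at hdisj
    have hdis : Disjoint D (⋃₀ 𝒟) := disjoint_sUnion_right.2 hdisj.2
    have h := hs D (⋃₀ 𝒟) (hc D (h𝒟 D (mem_insert _ _)))
      (ih (fun D hD => h𝒟 D (mem_insert_of_mem _ hD)) hdisj.1)
    rw [hdis.symmDiff_eq_sup] at h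
    rwa [sUnion_insert]

/-- If the circuits are the minimal nonempty members of a family that is closed under symmetric
differences, then that family consists of the cycles. -/
theorem cyc_eq_of_isCircuit_iff [M.Finite] {𝓕 : Set (Set α)} (hE : ∀ C ∈ 𝓕, C ⊆ M.E)
    (h0 : ∅ ∈ 𝓕) (hs : ∀ C ∈ 𝓕, ∀ D ∈ 𝓕, symmDiff C D ∈ 𝓕)
    (hc : ∀ C, M.IsCircuit C ↔ Minimal (fun C => C ∈ 𝓕 ∧ C.Nonempty) C) : M.Cyc = 𝓕 := by
  refine subset_antisymm (fun C hC => cyc_induction h0 (fun D hD => ((hc D).1 hD).prop.1)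
    (fun C D hC hD => hs C hC D hD) hC) fun C hC => ?_
  induction hn : C.ncard using Nat.strong_induction_on generalizing C with
  | _ n ih =>
  obtain rfl | hne := C.eq_empty_or_nonempty
  · exact empty_mem_cyc
  have hCfin : C.Finite := M.ground_finite.subset (hE C hC)
  have hfin : {D | D ⊆ C ∧ D ∈ 𝓕 ∧ D.Nonempty}.Finite :=
    hCfin.finite_subsets.subset fun D hD => hD.1
  obtain ⟨D, -, hD⟩ := hfin.isPWO.exists_le_minimal ⟨Subset.rfl, hC, hne⟩
  have hDC : D ⊆ C := hD.prop.1
  have hDcirc : M.IsCircuit D := (hc D).2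
    ⟨hD.prop.2, fun T hT hTD => hD.le_of_le ⟨hTD.trans hDC, hT⟩ hTD⟩
  -- Split off the minimal member `D`: the remainder is `symmDiff C D`, smaller than `C` and still
  -- in the family.
  have hdiff : C \ D ∈ 𝓕 := by
    have := hs C hC D hD.prop.2.1
    rwa [symmDiff_of_ge hDC] at this
  obtain ⟨𝒟, h𝒟, hdisj, hU⟩ := ih _ (hn ▸ ncard_lt_ncard (sdiff_lt hDC hD.prop.2.2.ne_empty) hCfin)
    _ hdiff rfl
  refine ⟨insert D 𝒟, ?_, ?_, ?_⟩
  · rintro T (rfl | hT)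
    exacts [hDcirc, h𝒟 T hT]
  · refine hdisj.insert fun T hT _ => ?_
    have : T ⊆ C \ D := hU ▸ subset_sUnion_of_mem hT
    exact (disjoint_sdiff_left.mono_left this).symm
  · rw [sUnion_insert, ← hU, union_sdiff_cancel hDC]

/-! ### Minors -/

theorem cyc_delete (X : Set α) : (M ＼ X).Cyc = {C | C ∈ M.Cyc ∧ Disjoint C X} := by
  ext C
  constructor
  · rintro ⟨𝒟, h𝒟, hdisj, rfl⟩
    simp only [delete_isCircuit_iff] at h𝒟
    exact ⟨⟨𝒟, fun D hD => (h𝒟 D hD).1, hdisj, rfl⟩,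
      disjoint_sUnion_left.2 fun D hD => (h𝒟 D hD).2⟩
  · rintro ⟨⟨𝒟, h𝒟, hdisj, rfl⟩, hX⟩
    exact ⟨𝒟, fun D hD => delete_isCircuit_iff.2 ⟨h𝒟 D hD, disjoint_sUnion_left.1 hX D hD⟩,
      hdisj, rfl⟩

/-- Removing `X` commutes with symmetric difference, so `cyc_eq_of_isCircuit_iff` applies once the
nonempty sets `C \ X` and the dependent sets of `M ／ X` have the same minimal members. Each such set
is dependent, and each circuit of `M ／ X` extends by elements of `X` to a circuit of `M`. -/
theorem cyc_contract [M.Finite] (hM : ∀ C ∈ M.Cyc, ∀ D ∈ M.Cyc, symmDiff C D ∈ M.Cyc)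
    (X : Set α) : (M ／ X).Cyc = (· \ X) '' M.Cyc := by
  refine cyc_eq_of_isCircuit_iff ?_ ⟨∅, empty_mem_cyc, empty_sdiff _⟩ ?_ ?_
  · rintro _ ⟨C, hC, rfl⟩
    exact (sdiff_subset_sdiff_left (subset_ground_of_mem_cyc hC) : C \ X ⊆ M.E \ X)
  · rintro _ ⟨C, hC, rfl⟩ _ ⟨D, hD, rfl⟩
    refine ⟨_, hM C hC D hD, ?_⟩
    ext e
    simp only [mem_sdiff, mem_symmDiff]
    tauto
  · intro C
    refine minimal_iff_minimal_of_imp_of_forall ?_ ?_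
    · rintro _ ⟨⟨C, hC, rfl⟩, e, he⟩
      obtain ⟨D, hDC, heD, hD⟩ := exists_isCircuit_mem_subset hC he.1
      exact (hD.contract_dep_of_not_subset fun h => he.2 (h heD)).superset
        (sdiff_subset_sdiff_left hDC)
        (sdiff_subset_sdiff_left (subset_ground_of_mem_cyc hC) : C \ X ⊆ M.E \ X)
    · intro D hD
      obtain ⟨C, hCD, hC⟩ := hD.exists_isCircuit_subset
      obtain ⟨C', hC', hCC', hC'X⟩ := hC.exists_subset_isCircuit_of_contract
      refine ⟨C, hCD, ⟨C', hC'.mem_cyc, ?_⟩, hC.nonempty⟩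
      refine subset_antisymm (fun e he => (hC'X he.1).resolve_right he.2) fun e he => ⟨hCC' he, ?_⟩
      exact (hC.subset_ground he).2

/-! ### Binary matroids -/

theorem not_linearIndepOn_zmod_two_iff {V : Type v} [AddCommGroup V] [Module (ZMod 2) V]
    {v : α → V} {I : Set α} :
    ¬ LinearIndepOn (ZMod 2) v I ↔ ∃ s : Finset α, (s : Set α) ⊆ I ∧ s.Nonempty ∧ ∑ e ∈ s, v e = 0 := by
  classical
  have h2 : ∀ x : ZMod 2, x ≠ 0 → x = 1 := by decide
  constructor
  · intro h
    rw [linearIndepOn_iff'] at h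
    push Not at h
    obtain ⟨s, g, hs, hsum, e, he, hge⟩ := h
    refine ⟨s.filter fun e => g e ≠ 0, fun x hx => hs (Finset.mem_filter.1 hx).1,
      ⟨e, Finset.mem_filter.2 ⟨he, hge⟩⟩, ?_⟩
    rw [← hsum, Finset.sum_filter]
    refine Finset.sum_congr rfl fun x _ => ?_
    split_ifs with hx
    · rw [h2 _ hx, one_smul]
    · rw [not_not.1 hx, zero_smul]
  · rintro ⟨s, hs, ⟨e, he⟩, hsum⟩ h
    rw [linearIndepOn_iff'] at h
    exact one_ne_zero (h s (fun _ => 1) hs (by simpa using hsum) e he)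

/-- Cycles are the supports of the vectors in the kernel of a representing matrix, and symmetric
difference is addition there. From here on only this closure property is carried along, in place of
a representation. -/
theorem IsBinary.symmDiff_mem_cyc [M.Finite] (hM : M.IsBinary) :
    ∀ C ∈ M.Cyc, ∀ D ∈ M.Cyc, symmDiff C D ∈ M.Cyc := by
  classical
  obtain ⟨m, A, hA⟩ := hM
  let v : α → Fin m → ZMod 2 := fun e => if h : e ∈ M.E then A.col ⟨e, h⟩ else 0
  have hv : ∀ I ⊆ M.E, (M.Indep I ↔ LinearIndepOn (ZMod 2) v I) := by
    intro I hI
    have h := hA (Subtype.val ⁻¹' I)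
    rw [Subtype.image_preimage_coe, inter_eq_self_of_subset_right hI] at h
    rw [h]
    have hcol : A.col = v ∘ Subtype.val := by
      ext ⟨e, he⟩ : 1
      simp [v, he]
    have himg : Subtype.val '' (Subtype.val ⁻¹' I : Set M.E) = I := by
      rw [Subtype.image_preimage_coe, inter_eq_self_of_subset_right hI]
    rw [hcol]
    refine ⟨fun h => ?_, fun h => ?_⟩
    · have := h.image_of_comp
      rwa [himg] at this
    · exact LinearIndepOn.comp_of_image (by rwa [himg]) Subtype.val_injective.injOn
  let 𝓕 : Set (Set α) := {C | ∃ s : Finset α, (s : Set α) = C ∧ C ⊆ M.E ∧ ∑ e ∈ s, v e = 0}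
  have hs : ∀ C ∈ 𝓕, ∀ D ∈ 𝓕, symmDiff C D ∈ 𝓕 := by
    rintro _ ⟨s, rfl, hsE, hs⟩ _ ⟨t, rfl, htE, ht⟩
    refine ⟨symmDiff s t, Finset.coe_symmDiff, ?_, ?_⟩
    · exact (symmDiff_le_sup (a := (s : Set α))).trans (union_subset hsE htE)
    · have h1 := Finset.sum_union_inter (s₁ := s) (s₂ := t) (f := v)
      rw [hs, ht, add_zero, ← Finset.sup_eq_union, ← symmDiff_sup_inf, Finset.sup_eq_union,
        Finset.sum_union (disjoint_symmDiff_inf _ _), Finset.inf_eq_inter, add_assoc,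
        ZModModule.add_self, add_zero] at h1
      exact h1
  suffices M.Cyc = 𝓕 by rwa [this]
  refine cyc_eq_of_isCircuit_iff ?_ ⟨∅, by simp, by simp, by simp⟩ hs ?_
  · rintro C ⟨_, _, h, _⟩
    exact h
  · intro C
    refine minimal_iff_minimal_of_imp_of_forall ?_ ?_
    · rintro _ ⟨⟨s, rfl, hsE, hs⟩, hne⟩
      refine ⟨?_, hsE⟩
      rw [hv _ hsE, not_linearIndepOn_zmod_two_iff]
      exact ⟨s, Subset.rfl, hne, hs⟩
    · rintro C ⟨hC, hCE⟩
      rw [hv _ hCE, not_linearIndepOn_zmod_two_iff] at hC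
      obtain ⟨s, hsC, hne, hs⟩ := hC
      exact ⟨s, hsC, ⟨s, rfl, hsC.trans hCE, hs⟩, hne⟩

end Matroid

namespace Matroid

universe u v w

variable {α : Type u} {M : Matroid α} {K : Type w} [Field K]

open MvPolynomial (X GeneratedInDegreeLE)

/-! ### The cycle homomorphism -/

/-- The variable `y_e` of an element `e` of the ground set, and `1` for all other `e`. -/
noncomputable def groundVar (K : Type w) [Field K] (M : Matroid α) (e : α) :
    MvPolynomial (Option M.E) K :=
  open Classical in if h : e ∈ M.E then X (some ⟨e, h⟩) else 1

theorem groundVar_of_mem {e : α} (h : e ∈ M.E) : groundVar K M e = X (some ⟨e, h⟩) :=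
  dif_pos h

theorem cycleHom_X (C : M.Cyc) {s : Finset α} (hs : (s : Set α) = C) :
    cycleHom K M (X C) = (∏ e ∈ s, groundVar K M e) * X none := by
  rw [cycleHom, MvPolynomial.aeval_X, ← finprod_mem_coe_finset, hs]
  congr 1
  have himg : Subtype.val '' (Subtype.val ⁻¹' (C : Set α) : Set M.E) = C := by
    rw [Subtype.image_preimage_coe, inter_eq_self_of_subset_right (subset_ground_of_mem_cyc C.2)]
  conv_rhs => rw [← himg]
  rw [finprod_mem_image Subtype.val_injective.injOn]
  refine finprod_congr fun e => ?_
  rw [groundVar_of_mem e.2]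
  rfl

theorem exists_finset_coe_eq [M.Finite] (C : M.Cyc) : ∃ s : Finset α, (s : Set α) = C :=
  (M.ground_finite.subset (subset_ground_of_mem_cyc C.2)).exists_finset_coe

/-- The homomorphism that sends `z` to itself and `y_e` to `g e`. -/
noncomputable def substHom {M : Matroid α} {β : Type v} {N : Matroid β}
    (g : α → MvPolynomial (Option N.E) K) :
    MvPolynomial (Option M.E) K →ₐ[K] MvPolynomial (Option N.E) K :=
  MvPolynomial.aeval fun o => o.elim (X none) fun e => g e

theorem substHom_groundVar {β : Type v} {N : Matroid β} (g : α → MvPolynomial (Option N.E) K)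
    {e : α} (he : e ∈ M.E) : substHom (M := M) g (groundVar K M e) = g e := by
  simp [groundVar_of_mem he, substHom]

theorem substHom_cycleHom_X {β : Type v} {N : Matroid β} (g : α → MvPolynomial (Option N.E) K)
    (C : M.Cyc) {s : Finset α} (hs : (s : Set α) = C) :
    substHom (M := M) g (cycleHom K M (X C)) = (∏ e ∈ s, g e) * X none := by
  rw [cycleHom_X C hs, map_mul, map_prod]
  congr 1
  · refine Finset.prod_congr rfl fun e he => substHom_groundVar g ?_
    exact subset_ground_of_mem_cyc C.2 (hs ▸ he)
  · simp [substHom]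

/-! ### Bounded generation of the cycle ideal passes to minors -/

theorem generatedInDegreeLE_delete [M.Finite] {d : ℕ}
    (h : GeneratedInDegreeLE (cycleIdeal K M) d) (D : Set α) :
    GeneratedInDegreeLE (cycleIdeal K (M ＼ D)) d := by
  classical
  have hcyc : ∀ C, C ∈ (M ＼ D).Cyc ↔ C ∈ M.Cyc ∧ Disjoint C D := fun C => by
    rw [cyc_delete]; rfl
  have hp : ∀ (C : Set α) (hC : C ∈ (M ＼ D).Cyc), (if h : C ∈ (M ＼ D).Cyc then X ⟨C, h⟩ else 0 :
      MvPolynomial (M ＼ D).Cyc K) = X ⟨C, hC⟩ := fun C hC => dif_pos hC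
  -- Setting `y_e = 0` for `e ∈ D` kills exactly the images of the cycles that meet `D`, matching
  -- `x_C ↦ 0`.
  refine GeneratedInDegreeLE.of_retract h
    (fun C => if h : (C : Set α) ∈ (M ＼ D).Cyc then X ⟨C, h⟩ else 0)
    (fun C => ⟨C, ((hcyc C).1 C.2).1⟩)
    (substHom fun e => if e ∈ D then 0 else groundVar K (M ＼ D) e)
    (substHom fun e => groundVar K M e) ?_ (fun C => hp C C.2) ?_ ?_
  · intro C
    by_cases hC : (C : Set α) ∈ (M ＼ D).Cyc
    · rw [hp _ hC]; exact MvPolynomial.isHomogeneous_X _ _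
    · rw [dif_neg hC]; exact MvPolynomial.isHomogeneous_zero _ _ _
  · intro C
    obtain ⟨s, hs⟩ := exists_finset_coe_eq C
    rw [substHom_cycleHom_X _ C hs]
    by_cases hC : (C : Set α) ∈ (M ＼ D).Cyc
    · rw [hp _ hC, cycleHom_X (M := M ＼ D) ⟨C, hC⟩ hs]
      congr 1
      refine Finset.prod_congr rfl fun e he => (if_neg ?_).symm
      exact disjoint_left.1 ((hcyc C).1 hC).2 (hs ▸ he)
    · rw [dif_neg hC, map_zero]
      have : ¬ Disjoint (C : Set α) D := fun h => hC ((hcyc C).2 ⟨C.2, h⟩)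
      obtain ⟨e, he, heD⟩ := not_disjoint_iff.1 this
      rw [← hs] at he
      refine (mul_eq_zero_of_left (Finset.prod_eq_zero he ?_) _).symm
      exact if_pos heD
  · intro C
    obtain ⟨s, hs⟩ := exists_finset_coe_eq C
    rw [substHom_cycleHom_X _ C hs]
    exact cycleHom_X _ hs

/-- Contraction of `D`, if the cycles of the contraction can be lifted along a map that sends each
`x ∈ D` to an element `a x` that it imitates. -/
theorem generatedInDegreeLE_contract [M.Finite] {d : ℕ}
    (hM : ∀ C ∈ M.Cyc, ∀ D ∈ M.Cyc, symmDiff C D ∈ M.Cyc)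
    (h : GeneratedInDegreeLE (cycleIdeal K M) d) {D : Set α} (hD : D ⊆ M.E) (a : α → α)
    (ha : ∀ C ∈ M.Cyc, (C \ D) ∪ {x | x ∈ D ∧ a x ∈ C \ D} ∈ M.Cyc) :
    GeneratedInDegreeLE (cycleIdeal K (M ／ D)) d := by
  classical
  have hDfin : D.Finite := M.ground_finite.subset hD
  obtain ⟨t, ht⟩ := hDfin.exists_finset_coe
  have hcyc := cyc_contract hM D
  have hmem : ∀ C : M.Cyc, (C : Set α) \ D ∈ (M ／ D).Cyc := fun C => by
    rw [hcyc]; exact ⟨C, C.2, rfl⟩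
  have hdisj : ∀ C ∈ (M ／ D).Cyc, Disjoint C D := fun C hC => by
    rw [hcyc] at hC
    obtain ⟨C, -, rfl⟩ := hC
    exact disjoint_sdiff_left
  have hlift : ∀ C ∈ (M ／ D).Cyc, C ∪ {x | x ∈ D ∧ a x ∈ C} ∈ M.Cyc := fun C hC => by
    rw [hcyc] at hC
    obtain ⟨C, hC, rfl⟩ := hC
    exact ha C hC
  -- The retraction sets `y_e = 1` on `D`. The section multiplies `y_e` by the `y_x` of all `x ∈ D`
  -- with `a x = e`, so that a lifted cycle contains `x` exactly when it contains `a x`.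
  refine GeneratedInDegreeLE.of_retract h (fun C => X ⟨C \ D, hmem C⟩)
    (fun C => ⟨_, hlift C C.2⟩)
    (substHom fun e => if e ∈ D then 1 else groundVar K (M ／ D) e)
    (substHom fun e => groundVar K M e * ∏ x ∈ t with a x = e, groundVar K M x)
    (fun C => MvPolynomial.isHomogeneous_X _ _) ?_ ?_ ?_
  · intro C
    congr 1
    refine Subtype.ext ?_
    change ((C : Set α) ∪ {x | x ∈ D ∧ a x ∈ (C : Set α)}) \ D = C
    have := disjoint_left.1 (hdisj C C.2)
    ext e
    simp only [mem_sdiff, mem_union, mem_ofPred_eq]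
    have := @this e
    tauto
  · intro C
    obtain ⟨s, hs⟩ := exists_finset_coe_eq C
    rw [substHom_cycleHom_X _ C hs, cycleHom_X (s := s.filter (· ∉ D)) _ (by
      ext e; simp [← hs])]
    rw [Finset.prod_filter]
    congr 1
    refine Finset.prod_congr rfl fun e he => ?_
    by_cases heD : e ∈ D
    · rw [if_pos heD, if_neg (not_not.2 heD)]
    · rw [if_neg heD, if_pos heD]
  · intro C
    obtain ⟨s, hs⟩ := exists_finset_coe_eq C
    have hs' : (((s ∪ t.filter (a · ∈ s) : Finset α)) : Set α) =
        (C : Set α) ∪ {x | x ∈ D ∧ a x ∈ (C : Set α)} := by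
      ext e; simp [← hs, ← ht]
    rw [substHom_cycleHom_X _ C hs, cycleHom_X _ hs', Finset.prod_union, Finset.prod_mul_distrib]
    · congr 2
      rw [← Finset.prod_fiberwise_of_maps_to (t := s) (g := a)
        (fun x hx => (Finset.mem_filter.1 hx).2)]
      refine Finset.prod_congr rfl fun e he => Finset.prod_congr ?_ fun _ _ => rfl
      ext x
      simp only [Finset.mem_filter]
      exact ⟨fun ⟨⟨hx, _⟩, h⟩ => ⟨hx, h⟩, fun ⟨hx, h⟩ => ⟨⟨hx, h ▸ he⟩, h⟩⟩
    · rw [← Finset.disjoint_coe, hs]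
      refine (hdisj C C.2).mono_right fun x hx => ?_
      rw [← ht]
      exact (Finset.mem_filter.1 hx).1

end Matroid

/-! ### Cuts -/

namespace SimpleGraph

universe u

/-- The coboundary of a `0`-`1`-labelling of the vertices. -/
def coboundary {V : Type u} (x : V → ZMod 2) : Sym2 V → ZMod 2 :=
  Sym2.lift ⟨fun a b => x a + x b, fun _ _ => add_comm _ _⟩

/-- The cut of a `0`-`1`-labelling: the edges that join vertices with different labels. -/
def cut {V : Type u} (x : V → ZMod 2) : Set (Sym2 V) := {e | coboundary x e ≠ 0}

theorem mk_mem_cut {V : Type u} {x : V → ZMod 2} {a b : V} : s(a, b) ∈ cut x ↔ x a ≠ x b := by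
  rw [← sub_ne_zero, ZModModule.sub_eq_add]
  rfl

theorem cut_subset_edgeSet {V : Type u} (x : V → ZMod 2) :
    cut x ⊆ (completeGraph V).edgeSet := by
  intro e he
  induction e with | _ a b =>
  rw [mk_mem_cut] at he
  rw [mem_edgeSet, completeGraph, top_adj]
  rintro rfl
  exact he rfl

theorem symmDiff_cut {V : Type u} (x y : V → ZMod 2) :
    symmDiff (cut x) (cut y) = cut (x + y) := by
  have h : ∀ p q r s : ZMod 2, (p ≠ q ∧ ¬ r ≠ s ∨ r ≠ s ∧ ¬ p ≠ q) ↔ p + r ≠ q + s := by decide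
  ext e
  induction e with | _ a b =>
  rw [mem_symmDiff, mk_mem_cut, mk_mem_cut, mk_mem_cut]
  exact h _ _ _ _

theorem cycleMatroid_indep {V : Type u} [Fintype V] {G : SimpleGraph V} {I : Set (Sym2 V)} :
    G.cycleMatroid.Indep I ↔ G.IsForestEdgeSet I := Iff.rfl

theorem isBase_cycleMatroid_of_isTree {V : Type u} [Fintype V] {T : SimpleGraph V}
    (hT : T.IsTree) : (completeGraph V).cycleMatroid.IsBase T.edgeSet := by
  rw [Matroid.isBase_iff_maximal_indep]
  have hsub : T.edgeSet ⊆ (completeGraph V).edgeSet := edgeSet_mono le_top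
  refine ⟨cycleMatroid_indep.2 ⟨hsub, by rw [fromEdgeSet_edgeSet]; exact hT.isAcyclic⟩,
    fun J hJ hTJ e he => ?_⟩
  by_contra heT
  induction e with | _ x y =>
  have hxy : x ≠ y := ((mem_edgeSet _).1 (hJ.1 he)).ne
  refine not_reachable_of_isAcyclic_insert hxy heT
    (hJ.2.anti (fromEdgeSet_mono (insert_subset he hTJ))) ?_
  rw [fromEdgeSet_edgeSet]
  exact hT.connected x y

theorem reachable_of_isBase_cycleMatroid {V : Type u} [Fintype V] {B : Set (Sym2 V)}
    (hB : (completeGraph V).cycleMatroid.IsBase B) (x y : V) : (fromEdgeSet B).Reachable x y := by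
  by_contra h
  have hxy : x ≠ y := fun hxy => h (hxy ▸ Reachable.refl x)
  have hBi := cycleMatroid_indep.1 hB.indep
  have hins : (completeGraph V).cycleMatroid.Indep (insert s(x, y) B) :=
    cycleMatroid_indep.2 ⟨insert_subset hxy hBi.1, isAcyclic_fromEdgeSet_insert hBi.2 h⟩
  have hmem : s(x, y) ∈ B := hB.eq_of_subset_indep hins (subset_insert _ _) ▸ mem_insert _ _
  exact h ((fromEdgeSet_adj B).2 ⟨hmem, hxy⟩).reachable

/-- The circuits of the dual of the cycle matroid of a complete graph are the minimal cuts. -/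
theorem isCircuit_dual_cycleMatroid_iff {V : Type u} [Fintype V] [Nonempty V]
    {C : Set (Sym2 V)} : (completeGraph V).cycleMatroid✶.IsCircuit C ↔
      Minimal (fun C => C ∈ range (cut (V := V)) ∧ C.Nonempty) C := by
  classical
  rw [← Matroid.isCocircuit_def, Matroid.isCocircuit_iff_minimal]
  refine minimal_iff_minimal_of_imp_of_forall ?_ ?_
  · rintro _ ⟨⟨x, rfl⟩, e, he⟩ B hB
    by_contra hne
    rw [not_nonempty_iff_eq_empty] at hne
    induction e with | _ a b =>
    rw [mk_mem_cut] at he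
    apply he
    obtain ⟨p⟩ := reachable_of_isBase_cycleMatroid hB a b
    -- A labelling whose cut misses `B` is constant along walks in `B`, and a base connects all
    -- vertices.
    clear he
    induction p with
    | nil => rfl
    | @cons a c b hac p ih =>
      refine Eq.trans ?_ ih
      by_contra hx
      exact (hne ▸ ⟨mk_mem_cut.2 hx, ((fromEdgeSet_adj B).1 hac).1⟩ : s(a, c) ∈ (∅ : Set (Sym2 V)))
  · intro C hC
    -- Otherwise a spanning tree in the complement would be a base missed by `C`. The cut around one
    -- component of the complement then lies inside `C`.
    have hnc : ¬ (fromEdgeSet Cᶜ).Connected := by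
      intro hconn
      obtain ⟨T, hT, hTtree⟩ := hconn.exists_isTree_le
      obtain ⟨e, heC, heT⟩ := hC _ (isBase_cycleMatroid_of_isTree hTtree)
      have := edgeSet_mono hT heT
      rw [edgeSet_fromEdgeSet] at this
      exact this.1 heC
    have : ∃ a b, ¬ (fromEdgeSet Cᶜ).Reachable a b := by
      by_contra! h
      exact hnc ⟨h⟩
    obtain ⟨a, b, hab⟩ := this
    refine ⟨cut fun c => if (fromEdgeSet Cᶜ).Reachable a c then 1 else 0, ?_, ⟨_, rfl⟩,
      s(a, b), mk_mem_cut.2 (by simp [hab])⟩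
    intro e he
    induction e with | _ c d =>
    by_contra hn
    rw [mk_mem_cut] at he
    have hcd : c ≠ d := fun h => he (by rw [h])
    have hr : (fromEdgeSet Cᶜ).Reachable c d := ((fromEdgeSet_adj _).2 ⟨hn, hcd⟩).reachable
    have : (fromEdgeSet Cᶜ).Reachable a c ↔ (fromEdgeSet Cᶜ).Reachable a d :=
      ⟨fun h => h.trans hr, fun h => h.trans hr.symm⟩
    exact he (by simp only [this])

theorem cyc_dual_cycleMatroid {V : Type u} [Fintype V] [Nonempty V] :
    (completeGraph V).cycleMatroid✶.Cyc = range (cut (V := V)) := by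
  have : (completeGraph V).cycleMatroid.Finite := ⟨Set.toFinite _⟩
  refine Matroid.cyc_eq_of_isCircuit_iff ?_ ⟨0, ?_⟩ ?_ fun C => isCircuit_dual_cycleMatroid_iff
  · rintro _ ⟨x, rfl⟩
    exact cut_subset_edgeSet x
  · refine eq_empty_of_forall_notMem fun e => ?_
    induction e with | _ a b =>
    simp [mk_mem_cut]
  · rintro _ ⟨x, rfl⟩ _ ⟨y, rfl⟩
    exact ⟨_, (symmDiff_cut x y).symm⟩

end SimpleGraph

namespace SimpleGraph

/-! ### Two multisets of cuts of `K₅` -/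

/-- The labelling of the vertices of `K₅` by the binary digits of a number less than `16`. -/
def bitLabel (c : Fin 16) (i : Fin 5) : ZMod 2 := if c.val.testBit i then 1 else 0

/-- Complementing a labelling does not change its cut, so vertex `4` may be given the label `0`, as
`bitLabel` does. This leaves 16 cuts. -/
theorem exists_bitLabel_add : ∀ x : Fin 5 → ZMod 2, ∃ c, ∀ i j,
    bitLabel c i + bitLabel c j = x i + x j := by
  decide +kernel

theorem bitLabel_add_injective : ∀ c d, (∀ i j,
    bitLabel c i + bitLabel c j = bitLabel d i + bitLabel d j) → c = d := by
  decide +kernel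

/-- The empty cut twice, and the four cuts that separate a pair `{0, j}` from the rest. -/
def pairCuts : Fin 16 → ℕ := ![2, 0, 0, 1, 0, 1, 0, 0, 0, 1, 0, 0, 0, 0, 1, 0]

/-- The star of the vertex `0` twice, and the stars of the other vertices. -/
def starCuts : Fin 16 → ℕ := ![0, 2, 1, 0, 1, 0, 0, 0, 1, 0, 0, 0, 0, 0, 0, 1]

theorem sum_starCuts : ∑ c, starCuts c = ∑ c, pairCuts c := by decide +kernel

/-- Both multisets separate `0` from any other vertex three times, and two distinct nonzero vertices
twice. Index 14 marks `{1, 2, 3}`, hence the cut of `{0, 4}`; index 15 gives the star of `4`. -/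
theorem sum_starCuts_ite : ∀ i j,
    (∑ c, if bitLabel c i ≠ bitLabel c j then starCuts c else 0) =
      ∑ c, if bitLabel c i ≠ bitLabel c j then pairCuts c else 0 := by decide +kernel

-- `h0` counts all cuts, and each other equation counts the cuts separating two given vertices. The
-- disjunction `hm` runs over the support of `pairCuts`.
set_option maxHeartbeats 2000000 in
theorem eq_pairCuts_of_equations {m : Fin 16 → ℕ}
    (h0 : m 0 + m 1 + m 2 + m 3 + m 4 + m 5 + m 6 + m 7 + m 8 + m 9 + m 10 + m 11 + m 12 + m 13 +
      m 14 + m 15 = 6)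
    (h01 : m 1 + m 2 + m 5 + m 6 + m 9 + m 10 + m 13 + m 14 = 3)
    (h02 : m 1 + m 3 + m 4 + m 6 + m 9 + m 11 + m 12 + m 14 = 3)
    (h03 : m 1 + m 3 + m 5 + m 7 + m 8 + m 10 + m 12 + m 14 = 3)
    (h04 : m 1 + m 3 + m 5 + m 7 + m 9 + m 11 + m 13 + m 15 = 3)
    (h12 : m 2 + m 3 + m 4 + m 5 + m 10 + m 11 + m 12 + m 13 = 2)
    (h13 : m 2 + m 3 + m 6 + m 7 + m 8 + m 9 + m 12 + m 13 = 2)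
    (h14 : m 2 + m 3 + m 6 + m 7 + m 10 + m 11 + m 14 + m 15 = 2)
    (h23 : m 4 + m 5 + m 6 + m 7 + m 8 + m 9 + m 10 + m 11 = 2)
    (h24 : m 4 + m 5 + m 6 + m 7 + m 12 + m 13 + m 14 + m 15 = 2)
    (h34 : m 8 + m 9 + m 10 + m 11 + m 12 + m 13 + m 14 + m 15 = 2)
    (hm : m 0 ≠ 0 ∨ m 3 ≠ 0 ∨ m 5 ≠ 0 ∨ m 9 ≠ 0 ∨ m 14 ≠ 0) : m = pairCuts := by
  have e1 : m 2 + m 15 + m 0 + m 13 = 2 := by omega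
  have e2 : m 4 + m 8 + m 0 + m 12 = 2 := by omega
  have e3 : m 3 + m 14 + 2 * m 12 + m 13 = m 0 := by omega
  have e4 : m 5 + m 9 + m 12 + 2 * m 13 = m 0 := by omega
  have e5 : m 6 + m 7 = m 12 + m 13 := by omega
  have e6 : m 10 + m 11 = m 12 + m 13 := by omega
  have e7 : 2 * m 3 + m 7 + m 11 + m 12 = m 0 := by omega
  have e8 : 2 * m 5 + m 7 + m 12 + 2 * m 13 = m 0 + m 11 := by omega
  have e9 : 2 * m 9 + m 11 + m 12 + 2 * m 13 = m 0 + m 7 := by omega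
  have e10 : m 1 + m 0 = 2 + m 12 + m 13 := by omega
  clear h0 h01 h02 h03 h04 h12 h13 h14 h23 h24 h34
  -- If `m 0 = 0`, then `e3` and `e4` make the whole support vanish, against `hm`. If `m 0 = 1`,
  -- they give `m 12 = m 13 = 0`, and `e7` becomes `2 * m 3 = 1`. The value `2` determines all other
  -- unknowns.
  have h0 : m 0 = 2 := by
    have hle : m 0 ≤ 2 := by omega
    interval_cases h : m 0
    · omega
    · have h12 : m 12 = 0 := by omega
      have h13 : m 13 = 0 := by omega
      omega
    · rfl
  clear hm
  have h12 : m 12 = 0 := by omega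
  have h13 : m 13 = 0 := by omega
  have h4 : m 4 = 0 := by omega
  have h8 : m 8 = 0 := by omega
  have h2 : m 2 = 0 := by omega
  have h15 : m 15 = 0 := by omega
  have h6 : m 6 = 0 := by omega
  have h7 : m 7 = 0 := by omega
  have h10 : m 10 = 0 := by omega
  have h11 : m 11 = 0 := by omega
  have h1 : m 1 = 0 := by omega
  have h3 : m 3 = 1 := by omega
  have h5 : m 5 = 1 := by omega
  have h9 : m 9 = 1 := by omega
  have h14 : m 14 = 1 := by omega
  funext c
  fin_cases c
  exacts [h0, h1, h2, h3, h4, h5, h6, h7, h8, h9, h10, h11, h12, h13, h14, h15]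

/-- No other multiset of cuts with the same edge multiplicities shares a cut with `pairCuts`. -/
theorem eq_pairCuts_of_sum_eq {m : Fin 16 → ℕ} (h0 : ∑ c, m c = ∑ c, pairCuts c)
    (h : ∀ i j, (∑ c, if bitLabel c i ≠ bitLabel c j then m c else 0) =
      ∑ c, if bitLabel c i ≠ bitLabel c j then pairCuts c else 0)
    (hm : ∃ c, m c ≠ 0 ∧ pairCuts c ≠ 0) : m = pairCuts := by
  have key : ∀ i j (l : List (Fin 16)) (k : ℕ), l.Nodup →
      (Finset.univ.filter fun c => bitLabel c i ≠ bitLabel c j) = l.toFinset →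
      (l.map pairCuts).sum = k → (l.map m).sum = k := by
    intro i j l k hl hs hk
    rw [← List.sum_toFinset _ hl, ← hs, Finset.sum_filter] at hk ⊢
    rw [h, hk]
  have k0 : (List.map m [0, 1, 2, 3, 4, 5, 6, 7, 8, 9, 10, 11, 12, 13, 14, 15]).sum = 6 := by
    have : ∑ c, pairCuts c = 6 := by decide +kernel
    rw [← List.sum_toFinset _ (by decide +kernel), ← this, ← h0]
    congr 1
  have h01 := key 0 1 [1, 2, 5, 6, 9, 10, 13, 14] 3 (by decide +kernel) (by decide +kernel) rfl
  have h02 := key 0 2 [1, 3, 4, 6, 9, 11, 12, 14] 3 (by decide +kernel) (by decide +kernel) rfl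
  have h03 := key 0 3 [1, 3, 5, 7, 8, 10, 12, 14] 3 (by decide +kernel) (by decide +kernel) rfl
  have h04 := key 0 4 [1, 3, 5, 7, 9, 11, 13, 15] 3 (by decide +kernel) (by decide +kernel) rfl
  have h12 := key 1 2 [2, 3, 4, 5, 10, 11, 12, 13] 2 (by decide +kernel) (by decide +kernel) rfl
  have h13 := key 1 3 [2, 3, 6, 7, 8, 9, 12, 13] 2 (by decide +kernel) (by decide +kernel) rfl
  have h14 := key 1 4 [2, 3, 6, 7, 10, 11, 14, 15] 2 (by decide +kernel) (by decide +kernel) rfl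
  have h23 := key 2 3 [4, 5, 6, 7, 8, 9, 10, 11] 2 (by decide +kernel) (by decide +kernel) rfl
  have h24 := key 2 4 [4, 5, 6, 7, 12, 13, 14, 15] 2 (by decide +kernel) (by decide +kernel) rfl
  have h34 := key 3 4 [8, 9, 10, 11, 12, 13, 14, 15] 2 (by decide +kernel) (by decide +kernel) rfl
  simp only [List.map_cons, List.map_nil, List.sum_cons, List.sum_nil, add_zero, ← add_assoc]
    at k0 h01 h02 h03 h04 h12 h13 h14 h23 h24 h34
  refine eq_pairCuts_of_equations k0 h01 h02 h03 h04 h12 h13 h14 h23 h24 h34 ?_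
  obtain ⟨c, hc, hu⟩ := hm
  have supp : ∀ c, pairCuts c ≠ 0 → c = 0 ∨ c = 3 ∨ c = 5 ∨ c = 9 ∨ c = 14 := by decide +kernel
  obtain rfl | rfl | rfl | rfl | rfl := supp c hu
  exacts [.inl hc, .inr (.inl hc), .inr (.inr (.inl hc)), .inr (.inr (.inr (.inl hc))),
    .inr (.inr (.inr (.inr hc)))]

end SimpleGraph

namespace Matroid

universe u v w

variable {α : Type u} {M : Matroid α} {K : Type w} [Field K]

open MvPolynomial (X monomial GeneratedInDegreeLE)

/-! ### Isomorphisms -/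

theorem isCircuit_image_of_indep_iff {β : Type v} {N : Matroid β} (f : M.E ≃ N.E)
    (hf : ∀ I : Set M.E, M.Indep (Subtype.val '' I) ↔ N.Indep (Subtype.val '' (f '' I)))
    {I : Set M.E} (hI : M.IsCircuit (Subtype.val '' I)) :
    N.IsCircuit (Subtype.val '' (f '' I)) := by
  rw [isCircuit_iff_forall_ssubset]
  refine ⟨⟨fun h => hI.not_indep ((hf I).2 h), Subtype.coe_image_subset _ _⟩, fun J hJ => ?_⟩
  have hJE : J ⊆ N.E := hJ.subset.trans (Subtype.coe_image_subset _ _)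
  have hJ' : Subtype.val '' (f '' (f.symm '' (Subtype.val ⁻¹' J : Set N.E))) = J := by
    rw [Equiv.image_symm_image, Subtype.image_preimage_coe, inter_eq_self_of_subset_right hJE]
  rw [← hJ', ← hf]
  rw [← hJ', ssubset_iff_subset_ne, image_subset_image_iff Subtype.val_injective,
    image_subset_image_iff f.injective] at hJ
  refine hI.ssubset_indep (ssubset_iff_subset_ne.2 ⟨image_mono hJ.1, fun h => hJ.2 ?_⟩)
  rw [Subtype.val_injective.image_injective h]

theorem image_mem_cyc {β : Type v} {N : Matroid β} [M.Finite] (f : M.E ≃ N.E)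
    (hf : ∀ I : Set M.E, M.Indep (Subtype.val '' I) ↔ N.Indep (Subtype.val '' (f '' I)))
    (hN : ∀ C ∈ N.Cyc, ∀ D ∈ N.Cyc, symmDiff C D ∈ N.Cyc) {C : Set α} (hC : C ∈ M.Cyc) :
    Subtype.val '' (f '' (Subtype.val ⁻¹' C)) ∈ N.Cyc := by
  refine cyc_induction (P := fun C => Subtype.val '' (f '' (Subtype.val ⁻¹' C)) ∈ N.Cyc)
    ?_ ?_ ?_ hC
  · simpa using empty_mem_cyc
  · intro C hC
    refine (isCircuit_image_of_indep_iff f hf ?_).mem_cyc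
    rwa [Subtype.image_preimage_coe, inter_eq_self_of_subset_right hC.subset_ground]
  · intro C D hC hD
    have h : (Subtype.val ⁻¹' symmDiff C D : Set M.E) =
      symmDiff (Subtype.val ⁻¹' C) (Subtype.val ⁻¹' D) := rfl
    rw [h, image_symmDiff f.injective, image_symmDiff Subtype.val_injective]
    exact hN _ hC _ hD

theorem cycleHom_X_eq_prod [Fintype M.E] (C : M.Cyc) [DecidablePred (· ∈ (C : Set α))] :
    cycleHom K M (X C) = (∏ e : M.E, if (e : α) ∈ (C : Set α) then X (some e) else 1) * X none := by
  rw [cycleHom, MvPolynomial.aeval_X, ← finprod_eq_prod_of_fintype]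
  congr 1
  exact finprod_congr fun e => finprod_eq_if

theorem cycleHom_X_eq_rename {β : Type v} {N : Matroid β} [M.Finite] (f : M.E ≃ N.E) {C : M.Cyc}
    {D : N.Cyc} (h : ∀ e, (f e : β) ∈ (D : Set β) ↔ (e : α) ∈ (C : Set α)) :
    cycleHom K N (X D) = MvPolynomial.rename (Option.map f) (cycleHom K M (X C)) := by
  classical
  have := M.ground_finite.fintype
  have := Fintype.ofEquiv _ f
  rw [cycleHom_X_eq_prod, cycleHom_X_eq_prod, map_mul, map_prod, MvPolynomial.rename_X]
  congr 1
  refine (Fintype.prod_equiv f _ _ fun e => ?_).symm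
  by_cases he : (e : α) ∈ (C : Set α)
  · rw [if_pos he, if_pos ((h e).2 he), MvPolynomial.rename_X]
    rfl
  · rw [if_neg he, if_neg (mt (h e).1 he), map_one]

/-- An isomorphism is a retract in which both maps rename variables. -/
theorem generatedInDegreeLE_of_isIsoTo {β : Type v} {N : Matroid β} [M.Finite] [N.Finite] {d : ℕ}
    (hM : ∀ C ∈ M.Cyc, ∀ D ∈ M.Cyc, symmDiff C D ∈ M.Cyc)
    (hN : ∀ C ∈ N.Cyc, ∀ D ∈ N.Cyc, symmDiff C D ∈ N.Cyc) (hMN : M.IsIsoTo N)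
    (h : GeneratedInDegreeLE (cycleIdeal K M) d) : GeneratedInDegreeLE (cycleIdeal K N) d := by
  obtain ⟨f, hf⟩ := hMN
  have hg : ∀ I : Set N.E,
      N.Indep (Subtype.val '' I) ↔ M.Indep (Subtype.val '' (f.symm '' I)) := fun I => by
    rw [hf (f.symm '' I), Equiv.image_symm_image]
  refine GeneratedInDegreeLE.of_retract h (fun C => X ⟨_, image_mem_cyc f hf hN C.2⟩)
    (fun C => ⟨_, image_mem_cyc f.symm hg hM C.2⟩)
    (MvPolynomial.rename (Option.map f)) (MvPolynomial.rename (Option.map f.symm))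
    (fun C => MvPolynomial.isHomogeneous_X _ _) (fun C => ?_)
    (fun C => cycleHom_X_eq_rename f fun e => by simp)
    (fun C => cycleHom_X_eq_rename f.symm fun e => by simp)
  congr 1
  refine Subtype.ext ?_
  change Subtype.val '' (f '' (Subtype.val ⁻¹' (Subtype.val '' (f.symm '' (Subtype.val ⁻¹'
    (C : Set β)))))) = C
  rw [preimage_image_eq _ Subtype.val_injective, Equiv.image_symm_image, Subtype.image_preimage_coe,
    inter_eq_self_of_subset_right (subset_ground_of_mem_cyc C.2)]

/-! ### Monomials of cycles -/

/-- The exponent vector of the image of `x_C` under the cycle homomorphism. -/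
noncomputable def cycleExponent (M : Matroid α) [M.Finite] (C : Set α) : Option M.E →₀ ℕ :=
  open Classical in
  have : Finite M.E := M.ground_finite
  Finsupp.equivFunOnFinite.symm fun o => o.elim 1 fun e => if (e : α) ∈ C then 1 else 0

@[simp]
theorem cycleExponent_none [M.Finite] (C : Set α) : M.cycleExponent C none = 1 := rfl

theorem cycleExponent_some [M.Finite] (C : Set α) [DecidablePred (· ∈ C)] (e : M.E) :
    M.cycleExponent C (some e) = if (e : α) ∈ C then 1 else 0 := by
  simp [cycleExponent]

theorem cycleHom_X_eq_monomial [M.Finite] (C : M.Cyc) :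
    cycleHom K M (X C) = monomial (M.cycleExponent C) 1 := by
  classical
  have := M.ground_finite.fintype
  rw [cycleHom_X_eq_prod, MvPolynomial.monomial_eq, MvPolynomial.C_1, one_mul,
    Finsupp.prod_fintype _ _ fun _ => pow_zero _, Fintype.prod_option, mul_comm]
  congr 1
  · exact (pow_one _).symm
  · refine Finset.prod_congr rfl fun e _ => ?_
    rw [cycleExponent_some, pow_ite, pow_one, pow_zero]

/-- The fibre of a monomial is thus cut out by linear equations: one for its degree and, by
`finsupp_sum_cycleExponent_some`, one for each element `e`, counting the cycles through `e`. -/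
theorem finsupp_sum_cycleExponent_none [M.Finite] [Fintype M.Cyc] (n : M.Cyc →₀ ℕ) :
    (n.sum fun C k => k • M.cycleExponent (C : Set α)) none = ∑ C, n C := by
  simp [Finsupp.sum_fintype, Finsupp.finsetSum_apply]

theorem finsupp_sum_cycleExponent_some [M.Finite] [Fintype M.Cyc] (n : M.Cyc →₀ ℕ) (e : M.E)
    [∀ C : M.Cyc, Decidable ((e : α) ∈ (C : Set α))] :
    (n.sum fun C k => k • M.cycleExponent (C : Set α)) (some e) =
      ∑ C : M.Cyc, if (e : α) ∈ (C : Set α) then n C else 0 := by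
  classical
  rw [Finsupp.sum_fintype _ _ (by simp), Finsupp.finsetSum_apply]
  refine Finset.sum_congr rfl fun C _ => ?_
  rw [Finsupp.smul_apply, cycleExponent_some, smul_eq_mul, mul_ite, mul_one, mul_zero]
  congr

end Matroid

namespace SimpleGraph

open Matroid

/-! ### The dual of the cycle matroid of `K₅` -/

instance : (completeGraph (Fin 5)).cycleMatroid✶.Finite := ⟨Set.toFinite _⟩

theorem cut_bitLabel_mem_cyc (c : Fin 16) :
    cut (bitLabel c) ∈ (completeGraph (Fin 5)).cycleMatroid✶.Cyc := by
  rw [cyc_dual_cycleMatroid]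
  exact mem_range_self _

theorem cut_eq_cut_iff {V : Type*} {x y : V → ZMod 2} :
    cut x = cut y ↔ ∀ i j, x i + x j = y i + y j := by
  have h2 : ∀ p q : ZMod 2, (p ≠ 0 ↔ q ≠ 0) ↔ p = q := by decide
  constructor
  · intro h i j
    rw [← h2]
    exact Set.ext_iff.1 h s(i, j)
  · intro h
    ext e
    induction e with | _ i j =>
    exact (h2 _ _).2 (h i j)

theorem bijective_cut_bitLabel : Function.Bijective fun c : Fin 16 =>
    (⟨cut (bitLabel c), cut_bitLabel_mem_cyc c⟩ :
      (completeGraph (Fin 5)).cycleMatroid✶.Cyc) := by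
  constructor
  · intro c d h
    exact bitLabel_add_injective c d (cut_eq_cut_iff.1 (Subtype.ext_iff.1 h))
  · rintro ⟨C, hC⟩
    obtain ⟨x, rfl⟩ := cyc_dual_cycleMatroid (V := Fin 5) ▸ hC
    obtain ⟨c, hc⟩ := exists_bitLabel_add x
    exact ⟨c, Subtype.ext (cut_eq_cut_iff.2 hc)⟩

/-- The cycle ideal of the dual of the cycle matroid of `K₅` needs a generator of degree `6`. -/
theorem not_generatedInDegreeLE_dual_cycleMatroid {K : Type*} [Field K] :
    ¬ MvPolynomial.GeneratedInDegreeLE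
      (cycleIdeal K (completeGraph (Fin 5)).cycleMatroid✶) 5 := by
  classical
  set N := (completeGraph (Fin 5)).cycleMatroid✶
  let E : Fin 16 ≃ N.Cyc := Equiv.ofBijective _ bijective_cut_bitLabel
  have : Fintype N.Cyc := Fintype.ofEquiv _ E
  have hE : ∀ (c : Fin 16) (i j : Fin 5),
      s(i, j) ∈ (E c : Set (Sym2 (Fin 5))) ↔ bitLabel c i ≠ bitLabel c j :=
    fun c i j => mk_mem_cut
  have hnone : ∀ n : N.Cyc →₀ ℕ,
      (n.sum fun C k => k • N.cycleExponent (C : Set (Sym2 (Fin 5)))) none = ∑ c, n (E c) :=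
    fun n => by rw [finsupp_sum_cycleExponent_none, ← E.sum_comp]
  have hsome : ∀ (n : N.Cyc →₀ ℕ) (i j : Fin 5) (h : s(i, j) ∈ N.E),
      (n.sum fun C k => k • N.cycleExponent (C : Set (Sym2 (Fin 5)))) (some ⟨s(i, j), h⟩) =
        ∑ c, if bitLabel c i ≠ bitLabel c j then n (E c) else 0 := fun n i j h => by
    rw [finsupp_sum_cycleExponent_some, ← E.sum_comp]
    exact Finset.sum_congr rfl fun c _ => if_congr (hE c i j) rfl rfl
  let toFinsupp : (Fin 16 → ℕ) → N.Cyc →₀ ℕ := fun m =>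
    Finsupp.equivFunOnFinite.symm (m ∘ E.symm)
  have happ : ∀ m c, toFinsupp m (E c) = m c := fun m c => by simp [toFinsupp]
  refine MvPolynomial.not_generatedInDegreeLE_of_fiber (u := toFinsupp pairCuts)
    (w := toFinsupp starCuts) (cycleHom_X_eq_monomial (K := K) (M := N)) ?_ ?_ ?_ ?_
  · have : (toFinsupp pairCuts).degree = ∑ c, pairCuts c := by
      rw [Finsupp.degree_eq_sum, ← E.sum_comp]
      simp only [happ]
    rw [this]
    decide +kernel
  · intro h
    have := DFunLike.congr_fun h (E 0)
    rw [happ, happ] at this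
    exact absurd this (by decide)
  · ext o
    rcases o with _ | ⟨e, he⟩
    · rw [hnone, hnone]
      simp only [happ]
      exact sum_starCuts
    · induction e with | _ i j =>
      rw [hsome, hsome]
      simp only [happ]
      exact sum_starCuts_ite i j
  · rintro n hn ⟨C, hC, hu⟩
    have hm : (fun c => n (E c)) = pairCuts := by
      refine eq_pairCuts_of_sum_eq ?_ (fun i j => ?_) ⟨E.symm C, by simpa using hC, ?_⟩
      · have := DFunLike.congr_fun hn none
        rw [hnone, hnone] at this
        simpa only [happ] using this
      -- A diagonal pair is no element of the ground set, but no labelling separates it and both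
      -- sums are zero.
      · by_cases hij : i = j
        · subst hij
          simp
        · have hE : s(i, j) ∈ N.E := hij
          have := DFunLike.congr_fun hn (some ⟨s(i, j), hE⟩)
          rw [hsome, hsome] at this
          simpa only [happ] using this
      · rwa [← happ pairCuts, E.apply_symm_apply]
    ext C
    obtain ⟨c, rfl⟩ := E.surjective C
    rw [happ]
    exact congrFun hm c

end SimpleGraph

namespace Matroid

universe u v w

variable {α : Type u} {M : Matroid α} {K : Type w} [Field K]

open MvPolynomial (GeneratedInDegreeLE)

/-! ### Bounded generation along minor operations -/

theorem homogeneousComponent_mem_cycleIdeal [M.Finite] {f : MvPolynomial M.Cyc K}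
    (hf : f ∈ cycleIdeal K M) (n : ℕ) :
    MvPolynomial.homogeneousComponent n f ∈ cycleIdeal K M :=
  MvPolynomial.homogeneousComponent_mem_ker cycleHom_X_eq_monomial
    (fun C => cycleExponent_none (C : Set α)) hf n

/-- A supremum over minimal generating sets says something only if one exists; homogeneity and
finiteness provide it. -/
theorem generatedInDegreeLE_of_mu_le [M.Finite] {d : ℕ} (h : M.mu K ≤ d) :
    GeneratedInDegreeLE (cycleIdeal K M) d := by
  have : Finite M.Cyc :=
    M.ground_finite.finite_subsets.subset fun C hC => subset_ground_of_mem_cyc hC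
  obtain ⟨S, hS⟩ := MvPolynomial.exists_isMinHomGenSet fun f hf n =>
    homogeneousComponent_mem_cycleIdeal (K := K) (M := M) hf n
  have hle : ∀ f ∈ S, f.totalDegree ≤ d := by
    intro f hf
    have h1 : ((f.totalDegree : ℕ∞) : WithBot ℕ∞) ≤ M.mu K := by
      unfold mu
      exact le_iSup_of_le S (le_iSup_of_le hS (le_iSup_of_le f (le_iSup_of_le hf le_rfl)))
    exact_mod_cast h1.trans h
  unfold MvPolynomial.GeneratedInDegreeLE
  conv_lhs => rw [← hS.prop.2]
  refine Ideal.span_mono fun f hf => ⟨hS.prop.2 ▸ Ideal.subset_span hf, ?_⟩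
  obtain ⟨k, hk⟩ := hS.prop.1 f hf
  -- Zero is homogeneous of every degree, so `k` need not be its total degree.
  by_cases hf0 : f = 0
  · exact ⟨0, Nat.zero_le _, hf0 ▸ MvPolynomial.isHomogeneous_zero _ _ _⟩
  · exact ⟨k, hk.totalDegree hf0 ▸ hle f hf, hk⟩

theorem symmDiff_mem_cyc_delete (hM : ∀ C ∈ M.Cyc, ∀ D ∈ M.Cyc, symmDiff C D ∈ M.Cyc)
    (X : Set α) : ∀ C ∈ (M ＼ X).Cyc, ∀ D ∈ (M ＼ X).Cyc, symmDiff C D ∈ (M ＼ X).Cyc := by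
  rw [cyc_delete]
  rintro C ⟨hC, hCX⟩ D ⟨hD, hDX⟩
  exact ⟨hM C hC D hD, (hCX.sup_left hDX).mono_left symmDiff_le_sup⟩

theorem symmDiff_mem_cyc_contract [M.Finite]
    (hM : ∀ C ∈ M.Cyc, ∀ D ∈ M.Cyc, symmDiff C D ∈ M.Cyc) (X : Set α) :
    ∀ C ∈ (M ／ X).Cyc, ∀ D ∈ (M ／ X).Cyc, symmDiff C D ∈ (M ／ X).Cyc := by
  rw [cyc_contract hM]
  rintro _ ⟨C, hC, rfl⟩ _ ⟨D, hD, rfl⟩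
  refine ⟨_, hM C hC D hD, ?_⟩
  ext e
  simp only [mem_sdiff, mem_symmDiff]
  tauto

/-- A circuit and a cocircuit never meet in exactly one element. Hence `f` is an element that `e`
copies. -/
theorem mem_iff_mem_of_isCocircuit_pair {e f : α} (hef : M.IsCocircuit {e, f}) {C : Set α}
    (hC : C ∈ M.Cyc) : e ∈ C ↔ f ∈ C := by
  have key : ∀ {e f : α}, M.IsCocircuit {e, f} → e ∈ C → f ∈ C := by
    intro e f hef he
    obtain ⟨D, hDC, heD, hD⟩ := exists_isCircuit_mem_subset hC he
    by_contra hf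
    refine hD.inter_isCocircuit_ne_singleton hef (e := e) ?_
    ext x
    simp only [mem_inter_iff, mem_insert_iff, mem_singleton_iff]
    constructor
    · rintro ⟨hx, rfl | rfl⟩
      · rfl
      · exact absurd (hDC hx) hf
    · rintro rfl
      exact ⟨heD, .inl rfl⟩
  exact ⟨key hef, key (pair_comm e f ▸ hef)⟩

theorem notMem_of_isColoop {e : α} (he : M.IsColoop e) {C : Set α} (hC : C ∈ M.Cyc) : e ∉ C := by
  intro heC
  obtain ⟨D, -, heD, hD⟩ := exists_isCircuit_mem_subset hC heC
  exact he.notMem_isCircuit hD heD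

/-- In a binary matroidal retract every cycle meets the two distinguished sets in corresponding
subsets up to complementation. -/
theorem retract_condition_cyc [M.Finite] {s : ℕ} {a a' : Fin s → α}
    (ha : Function.Injective a) (ha' : Function.Injective a')
    (h : ∀ C, M.IsCircuit C → ∀ J : Set (Fin s), J ≠ univ →
      (C ∩ range a' = a' '' J → C ∩ range a = a '' J ∨ C ∩ range a = range a \ a '' J) ∧
      (C ∩ range a = a '' J → C ∩ range a' = a' '' J ∨ C ∩ range a' = range a' \ a' '' J))
    {C : Set α} (hC : C ∈ M.Cyc) : a' ⁻¹' C = a ⁻¹' C ∨ a' ⁻¹' C = (a ⁻¹' C)ᶜ := by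
  have himg : ∀ (b : Fin s → α) (D : Set α), D ∩ range b = b '' (b ⁻¹' D) := fun b D =>
    (image_preimage_eq_inter_range).symm
  have hcompl : ∀ (b : Fin s → α), Function.Injective b → ∀ (J : Set (Fin s)),
      range b \ b '' J = b '' Jᶜ := fun b hb J => by
    rw [image_compl_eq_range_sdiff_image hb]
  refine cyc_induction (P := fun C => a' ⁻¹' C = a ⁻¹' C ∨ a' ⁻¹' C = (a ⁻¹' C)ᶜ) (.inl rfl)
    (fun D hD => ?_) (fun D D' hD hD' => ?_) hC
  -- The hypothesis speaks of proper index sets only; two full traces agree anyway.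
  · by_cases hu : a ⁻¹' D = univ
    · by_cases hu' : a' ⁻¹' D = univ
      · exact .inl (hu'.trans hu.symm)
      · have := (h D hD _ hu').1 (himg a' D)
        rw [himg, hcompl a ha, ha.image_injective.eq_iff, ha.image_injective.eq_iff] at this
        refine this.imp Eq.symm fun h => ?_
        rw [h, compl_compl]
    · have := (h D hD _ hu).2 (himg a D)
      rwa [himg, hcompl a' ha', ha'.image_injective.eq_iff, ha'.image_injective.eq_iff] at this
  -- Complementing one argument complements a symmetric difference; complementing both leaves it
  -- unchanged.
  · have hs : ∀ b : Fin s → α, b ⁻¹' (symmDiff D D') = symmDiff (b ⁻¹' D) (b ⁻¹' D') :=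
      fun _ => rfl
    rw [hs, hs]
    rcases hD with hD | hD <;> rcases hD' with hD' | hD' <;> rw [hD, hD']
    · exact .inl rfl
    · right; ext i; simp only [mem_symmDiff, mem_compl_iff]; tauto
    · right; ext i; simp only [mem_symmDiff, mem_compl_iff]; tauto
    · left; ext i; simp only [mem_symmDiff, mem_compl_iff]; tauto

/-- Let `a' i` copy `a i`. If the traces of a cycle `C` agree, restoring the contracted elements
returns `C`; if they are complementary, it returns the symmetric difference of `C` with the circuit
`range a'`. Both are cycles. -/
theorem generatedInDegreeLE_retract [M.Finite] {d : ℕ}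
    (hM : ∀ C ∈ M.Cyc, ∀ D ∈ M.Cyc, symmDiff C D ∈ M.Cyc)
    (h : GeneratedInDegreeLE (cycleIdeal K M) d) {s : ℕ} {a a' : Fin s → α}
    (ha : Function.Injective a) (ha' : Function.Injective a')
    (hdisj : Disjoint (range a) (range a')) (hcirc : M.IsCircuit (range a'))
    (hret : ∀ C, M.IsCircuit C → ∀ J : Set (Fin s), J ≠ univ →
      (C ∩ range a' = a' '' J → C ∩ range a = a '' J ∨ C ∩ range a = range a \ a '' J) ∧
      (C ∩ range a = a '' J → C ∩ range a' = a' '' J ∨ C ∩ range a' = range a' \ a' '' J)) :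
    GeneratedInDegreeLE (cycleIdeal K (M ／ range a')) d := by
  have hext : ∀ i, Function.extend a' a id (a' i) = a i := fun i => ha'.extend_apply _ _ i
  refine generatedInDegreeLE_contract hM h hcirc.subset_ground (Function.extend a' a id) ?_
  intro C hC
  have hnot : ∀ i, a i ∉ range a' := fun i => disjoint_left.1 hdisj (mem_range_self i)
  have hlift : ∀ x, x ∈ (C \ range a') ∪ {x | x ∈ range a' ∧
      Function.extend a' a id x ∈ C \ range a'} ↔ x ∈ C ∧ x ∉ range a' ∨ ∃ i, a' i = x ∧ a i ∈ C := by
    intro x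
    simp only [mem_union, mem_sdiff, mem_ofPred_eq]
    refine or_congr_right ⟨?_, ?_⟩
    · rintro ⟨⟨i, rfl⟩, hi, -⟩
      rw [hext] at hi
      exact ⟨i, rfl, hi⟩
    · rintro ⟨i, rfl, hi⟩
      rw [hext]
      exact ⟨mem_range_self i, hi, hnot i⟩
  rcases retract_condition_cyc ha ha' hret hC with hJ | hJ
  · convert hC using 1
    ext x
    rw [hlift]
    by_cases hx : x ∈ range a'
    · obtain ⟨i, rfl⟩ := hx
      have := Set.ext_iff.1 hJ i
      simp only [mem_preimage] at this
      simp [ha'.eq_iff, this]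
    · have : ¬ ∃ i, a' i = x ∧ a i ∈ C := fun ⟨i, hi, _⟩ => hx ⟨i, hi⟩
      tauto
  · convert hM C hC _ hcirc.mem_cyc using 1
    ext x
    rw [hlift, mem_symmDiff]
    by_cases hx : x ∈ range a'
    · obtain ⟨i, rfl⟩ := hx
      have := Set.ext_iff.1 hJ i
      simp only [mem_preimage, mem_compl_iff] at this
      simp [ha'.eq_iff, this]
    · have : ¬ ∃ i, a' i = x ∧ a i ∈ C := fun ⟨i, hi, _⟩ => hx ⟨i, hi⟩
      tauto

/-- Finiteness and closure under symmetric difference belong to the induction because every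
contraction step uses them for the current minor. -/
theorem IsGSeriesMinorOf.generatedInDegreeLE {M' : Matroid α} (h : M.IsGSeriesMinorOf M')
    [hfin : M.Finite] {d : ℕ} (hM : ∀ C ∈ M.Cyc, ∀ D ∈ M.Cyc, symmDiff C D ∈ M.Cyc)
    (hd : GeneratedInDegreeLE (cycleIdeal K M) d) :
    M'.Finite ∧ (∀ C ∈ M'.Cyc, ∀ D ∈ M'.Cyc, symmDiff C D ∈ M'.Cyc) ∧
      GeneratedInDegreeLE (cycleIdeal K M') d := by
  induction h with
  | refl => exact ⟨hfin, hM, hd⟩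
  | @tail N N' _ hstep ih =>
    obtain ⟨hN, hsymm, hgen⟩ := ih
    rcases hstep with ⟨e, -, rfl⟩ | ⟨e, f, hef, hcc, rfl⟩ | ⟨e, he, rfl⟩ |
      ⟨-, s, a, a', -, ha, ha', hdisj, -, -, hcirc, hret, rfl⟩
    · exact ⟨inferInstance, symmDiff_mem_cyc_delete hsymm _, generatedInDegreeLE_delete hgen _⟩
    · refine ⟨inferInstance, symmDiff_mem_cyc_contract hsymm _, generatedInDegreeLE_contract hsymm
        hgen (singleton_subset_iff.2 (hcc.subset_ground (mem_insert _ _))) (fun _ => f) ?_⟩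
      intro C hC
      convert hC using 1
      have := mem_iff_mem_of_isCocircuit_pair hcc hC
      ext x
      by_cases hx : x = e
      · subst hx
        simp [this, hef.symm]
      · simp [hx]
    -- With `a = id` nothing is ever restored, as it should be: a coloop lies in no cycle.
    · refine ⟨inferInstance, symmDiff_mem_cyc_contract hsymm _, generatedInDegreeLE_contract hsymm
        hgen (singleton_subset_iff.2 he.mem_ground) id ?_⟩
      intro C hC
      convert hC using 1
      have := notMem_of_isColoop he hC
      ext x
      by_cases hx : x = e
      · subst hx
        simp [this]
      · simp [hx]
    · exact ⟨inferInstance, symmDiff_mem_cyc_contract hsymm _,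
        generatedInDegreeLE_retract hsymm hgen ha ha' hdisj hcirc hret⟩

end Matroid

/-! ### The two implications. -/

theorem mainTheorem11 {α : Type*} (K : Type*) [Field K] (M : Matroid α) [M.Finite]
    (hM : M.IsBinary) :
    (M.mu K ≤ 5 → M.GSeriesMinorFree (SimpleGraph.completeGraph (Fin 5)).cycleMatroid✶) ∧
    (M.GSeriesMinorFree (SimpleGraph.completeGraph (Fin 5)).cycleMatroid✶ →
      M.SeriesColoopMinorFree (SimpleGraph.completeGraph (Fin 5)).cycleMatroid✶) := by
  constructor
  · rintro hmu ⟨M', hM', hiso⟩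
    obtain ⟨hfin, hsymm, hgen⟩ := hM'.generatedInDegreeLE (K := K) hM.symmDiff_mem_cyc
      (Matroid.generatedInDegreeLE_of_mu_le (d := 5) hmu)
    refine SimpleGraph.not_generatedInDegreeLE_dual_cycleMatroid
      (Matroid.generatedInDegreeLE_of_isIsoTo hsymm ?_ hiso hgen)
    rw [SimpleGraph.cyc_dual_cycleMatroid]
    rintro _ ⟨x, rfl⟩ _ ⟨y, rfl⟩
    exact ⟨_, (SimpleGraph.symmDiff_cut x y).symm⟩
  · rintro h ⟨M', hM', hiso⟩
    refine h ⟨M', ?_, hiso⟩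
    clear hiso
    induction hM' with
    | refl => exact .refl
    | tail _ hstep ih =>
      exact .tail ih (hstep.imp_right fun h => h.imp_right .inl)
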